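/- Let $(X,\mu)$ be a Lebesgue space (a standard Borel probability space without atoms), let $T$ be an automorphism (invertible bimeasurable $\mu$-preserving map) of $X$, and consider $T\times T$ on $(X\times X,\mu\otimes\mu)$. *Definitions.* For finite measurable partitions $\xi_j$ of a probability space write $\xi_j\to\varepsilon$ if for every measurable set $A$ there are unions $A_j$ of atoms of $\xi_j$ such that the measure of $A\,\triangle\,A_j$ tends to $0$. For an automorphism $S$ of a probability space $(Z,\nu)$: * $\mathrm{Rank}(S)$ is the least $r\in\mathbb N$ for which there are partitions $\xi_j\to\varepsilon$ of $Z$ of the form $$\xi_j=\{B_j^1,SB_j^1,\dots,S^{h_j^1}B_j^1,\ \dots,\ B_j^r,SB_j^r,\dots,S^{h_j^r}B_j^r,\ Y_j\},$$ and $\mathrm{Rank}(S)=\infty$ if there is no such $r$. * The local rank $\beta(S)$ is the largest $\beta\ge 0$ for which there are finite partitions $\xi_j\to\varepsilon$ of $Z$ of the form $\xi_j=\{B_j,SB_j,\dots,S^{h_j-1}B_j,\dots\}$ (the other atoms are arbitrary) such that $\nu\bigl(\bigsqcup_{0\le k<h_j}S^kB_j\bigr)\to\beta$. For $\kappa\in(0,1)$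 the automorphism $T$ is $\kappa$-mixing if there is a sequence of natural numbers $n_i\to\infty$ such that $\widehat T^{\,n_i}\to(1-\kappa)I+\kappa\Theta$ in the weak operator topology of $L_2(X,\mu)$, where $\widehat T f=f\circ T$ and $\Theta$ is the orthogonal projection onto the constants. *Theorem.* 1. (a) $\mathrm{Rank}(T\times T)=\infty$; (b) $\beta(T\times T)\le\frac14$. 2. If $T\times T$ is ergodic and $\beta(T\times T)=\frac14$, then $T$ is $\kappa$-mixing with $\kappa=\frac12$, that is, $\widehat T^{\,n_i}\to\frac12 I+\frac12\Theta$ weakly for some $n_i\to\infty$. -/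

import Mathlib

open MeasureTheory Filter Topology
open scoped ENNReal symmDiff

namespace ErgodicRank

variable {α : Type*} [MeasurableSpace α]

/-- The indexed family `P` is a partition of `α` into measurable sets (empty atoms are allowed). -/
def IsMeasurablePartition {ι : Type*} (P : ι → Set α) : Prop :=
  (∀ i, MeasurableSet (P i)) ∧ Pairwise (fun i i' => Disjoint (P i) (P i')) ∧
    ⋃ i, P i = Set.univ

/-- `ξ_j → ε`: every fixed measurable set `A` is approximated, as `j → ∞`, by `ξ_j`-measurable
sets, that is, by unions of atoms of `ξ_j`. -/
def TendsToPoints (μ : Measure α) {ι : ℕ → Type*} (ξ : ∀ j, ι j → Set α) : Prop :=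
  ∀ A : Set α, MeasurableSet A →
    ∃ F : ∀ j, Set (ι j), Tendsto (fun j => μ (A ∆ ⋃ i ∈ F j, ξ j i)) atTop (𝓝 0)

/-- The floor `S^k B` of the tower over `B`. -/
def floor (S : α ≃ᵐ α) (B : Set α) (k : ℕ) : Set α := (⇑S)^[k] '' B

/-- There is a sequence of partitions `ξ_j → ε` of the form
`ξ_j = {B_j^1, S B_j^1, …, S^{h_j^1} B_j^1, …, B_j^r, S B_j^r, …, S^{h_j^r} B_j^r, Y_j}`. -/
def HasTowers (S : α ≃ᵐ α) (μ : Measure α) (r : ℕ) : Prop :=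
  ∃ (h : ℕ → Fin r → ℕ) (B : ℕ → Fin r → Set α) (Y : ℕ → Set α)
    (ξ : ∀ j, (Σ i : Fin r, Fin (h j i + 1)) ⊕ Unit → Set α),
    (∀ j, ξ j = Sum.elim (fun p => floor S (B j p.1) p.2) (fun _ => Y j)) ∧
    (∀ j, IsMeasurablePartition (ξ j)) ∧ TendsToPoints μ ξ

/-- The rank of `S`: the least `r` such that approximating sequences of `r` towers exist, and `⊤`
if there is no such `r`. -/
noncomputable def rank (S : α ≃ᵐ α) (μ : Measure α) : ℕ∞ :=
  ⨅ (r : ℕ) (_ : HasTowers S μ r), (r : ℕ∞)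

/-- There is a sequence of finite partitions `ξ_j → ε` of the whole space, of the form
`ξ_j = {B_j, S B_j, …, S^{h_j - 1} B_j, …}` (the remaining atoms being the sets `C_j i`), such that
the measures of the towers `U_j = ⊔_{k < h_j} S^k B_j` tend to `b`. -/
def HasLocalTowers (S : α ≃ᵐ α) (μ : Measure α) (b : ℝ≥0∞) : Prop :=
  ∃ (h m : ℕ → ℕ) (B : ℕ → Set α) (C : ∀ j, Fin (m j) → Set α)
    (ξ : ∀ j, Fin (h j) ⊕ Fin (m j) → Set α),
    (∀ j, ξ j = Sum.elim (fun k : Fin (h j) => floor S (B j) k) (C j)) ∧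
    (∀ j, IsMeasurablePartition (ξ j)) ∧ TendsToPoints μ ξ ∧
    Tendsto (fun j => μ (⋃ k : Fin (h j), floor S (B j) k)) atTop (𝓝 b)

/-- The local rank `β(S)`: the largest `b` which is the limit of the measures of the towers of an
approximating sequence. -/
noncomputable def localRank (S : α ≃ᵐ α) (μ : Measure α) : ℝ≥0∞ :=
  sSup {b | HasLocalTowers S μ b}

/-- The unitary operator `f ↦ f ∘ T` on `L²(μ)` induced by an automorphism `T`. -/
noncomputable def koopman {μ : Measure α} (T : α ≃ᵐ α) (hT : MeasurePreserving T μ μ) :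
    Lp ℂ 2 μ →L[ℂ] Lp ℂ 2 μ :=
  (Lp.compMeasurePreservingₗᵢ ℂ T hT).toContinuousLinearMap

/-- The orthogonal projection `Θ` of `L²(μ)` onto the space of constants. -/
noncomputable def theta (μ : Measure α) [IsFiniteMeasure μ] : Lp ℂ 2 μ →L[ℂ] Lp ℂ 2 μ :=
  (Submodule.span ℂ {Lp.const 2 μ (1 : ℂ)}).starProjection

/-- `T` is `κ`-mixing, `κ ∈ (0, 1)`: for some sequence `n i → ∞` the operators `T ^ (n i)` converge
to `(1 - κ) I + κ Θ` in the weak operator topology of `L²(μ)`. -/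
def IsKappaMixing {μ : Measure α} [IsFiniteMeasure μ] (T : α ≃ᵐ α)
    (hT : MeasurePreserving T μ μ) (κ : ℝ) : Prop :=
  κ ∈ Set.Ioo (0 : ℝ) 1 ∧ ∃ n : ℕ → ℕ, Tendsto n atTop atTop ∧ ∀ f g : Lp ℂ 2 μ,
    Tendsto (fun i => inner ℂ g ((koopman T hT ^ n i) f)) atTop
      (𝓝 (inner ℂ g (((1 - κ : ℂ) • ContinuousLinearMap.id ℂ (Lp ℂ 2 μ)
        + (κ : ℂ) • theta μ) f)))

end ErgodicRank

/-! A tall tower of `S` controls the `S × S`-invariant couplings which charge pairs of nearby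
floors. By invariance the coupling gives equal mass to all floor rectangles `(a + t, b + t)` of a
diagonal. So a relation between finitely many resolved sets which holds almost surely for the
coupling holds approximately, on some diagonal, for the points `(S^a z, S^b z)` with `z` in most of
the tower. This is `exists_iterates_avoiding`, used as `exists_iterates_agree`, with `S = T × T` and
two kinds of coupling.

Infinite rank. Take the law of `((x, y), (y, w))` with independent coordinates. If boundedly many
towers filled the space, a Ramsey argument on independent points (`exists_pathCoupling_mass`) would
put a definite mass of this coupling on pairs lying in one tower at distance at most half its
height. Then `T^a y ≈ T^b x` on a set of definite measure, whereas the diagonal is null for `μ ⊗ μ`.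

Local rank. Take the law of `(z, (id × T^m) z)`. Among boundedly many shifts of the tower two must
overlap nearly floor by floor (`exists_shiftCoupling_mass`). This gives `m`, `a`, `b` such that on
most of the tower `T^a x ≈ T^b x` in the first coordinate and `T^(m+a) y ≈ T^b y` in the second.
Hence `β` is at most about `g₁ g₂`, where `g₁`, `g₂` are the measures of these two events in `X`. On
aperiodic points the events are almost disjoint, so `g₁ + g₂ ≤ 1` and `g₁ g₂ ≤ 1/4` up to errors.
Periodic points are treated separately: tall towers avoid them.

Equality. If `β = 1/4`, both events have measure about `1/2` and are almost complementary. Imposing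
the relations along a long orbit segment makes the first event almost invariant, so by ergodicity it
is almost independent of any prescribed finite family of sets. If moreover `m` is a mixing time of
the weakly mixing `T`, then `T^b` behaves relative to `T^a` like the identity on half of the space
and like a mixing power on the other half; `|b - a|` is the required time. -/

namespace ErgodicRank

/-! ### Towers and invariant couplings. -/

section Towers

variable {Z : Type*} [MeasurableSpace Z] {ν : Measure Z} {S : Z ≃ᵐ Z} {B : Set Z} {h : ℕ}

/-- The sets `B, S B, …, S^(h-1) B` are measurable and pairwise disjoint. -/
structure IsTower (S : Z ≃ᵐ Z) (B : Set Z) (h : ℕ) : Prop where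
  meas : ∀ k < h, MeasurableSet (floor S B k)
  disj : ∀ k < h, ∀ l < h, k ≠ l → Disjoint (floor S B k) (floor S B l)

/-- The union of the floors of a tower. -/
def towerSet (S : Z ≃ᵐ Z) (B : Set Z) (h : ℕ) : Set Z := ⋃ k ∈ Finset.range h, floor S B k

/-- Every floor of the tower lies inside `A` or outside `A`. -/
def Saturated (S : Z ≃ᵐ Z) (B : Set Z) (h : ℕ) (A : Set Z) : Prop :=
  ∀ k < h, floor S B k ⊆ A ∨ Disjoint (floor S B k) A

/-- Up to an error of measure at most `e`, the set `A` is saturated with respect to the tower. -/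
def Resolves (ν : Measure Z) (S : Z ≃ᵐ Z) (B : Set Z) (h : ℕ) (A : Set Z) (e : ℝ) : Prop :=
  ∃ A', MeasurableSet A' ∧ Saturated S B h A' ∧ ν.real (A ∆ A') ≤ e

/-- The pairs of points of the tower whose floors are at distance at most `q`. -/
def nearFloors (S : Z ≃ᵐ Z) (B : Set Z) (h q : ℕ) : Set (Z × Z) :=
  {p | ∃ k < h, ∃ l < h, k ≤ l + q ∧ l ≤ k + q ∧ p.1 ∈ floor S B k ∧ p.2 ∈ floor S B l}

@[simp] lemma floor_zero : floor S B 0 = B := by simp [floor]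

lemma iterate_mem_floor_add {z : Z} {k m : ℕ} :
    S^[m] z ∈ floor S B (m + k) ↔ z ∈ floor S B k := by
  rw [floor, Function.iterate_add, Set.image_comp]
  exact (S.injective.iterate m).mem_set_image

lemma mem_floor_succ {z : Z} {k : ℕ} : S z ∈ floor S B (k + 1) ↔ z ∈ floor S B k := by
  rw [add_comm]; exact iterate_mem_floor_add (m := 1)

lemma mem_towerSet {z : Z} : z ∈ towerSet S B h ↔ ∃ k < h, z ∈ floor S B k := by
  simp [towerSet]

lemma measureReal_floor (hS : MeasurePreserving S ν ν) (k : ℕ) :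
    ν.real (floor S B k) = ν.real B := by
  have : ∀ E : Set Z, ν (S '' E) = ν E := fun E => by
    rw [← hS.measure_preimage_equiv (S '' E), Set.preimage_image_eq _ S.injective]
  induction k with
  | zero => simp
  | succ k ih =>
    rw [← ih, floor, Function.iterate_succ', Set.image_comp, Measure.real, this]
    rfl

lemma IsTower.measurableSet_towerSet (ht : IsTower S B h) : MeasurableSet (towerSet S B h) :=
  Finset.measurableSet_biUnion _ fun k hk => ht.meas k (Finset.mem_range.1 hk)

lemma IsTower.measurableSet_nearFloors (ht : IsTower S B h) (q : ℕ) :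
    MeasurableSet (nearFloors S B h q) := by
  have : nearFloors S B h q = ⋃ k ∈ Finset.range h, ⋃ l ∈ (Finset.range h).filter
      (fun l => k ≤ l + q ∧ l ≤ k + q), floor S B k ×ˢ floor S B l := by
    ext p
    simp only [nearFloors, Set.mem_ofPred_eq, Set.mem_iUnion, Finset.mem_range, Finset.mem_filter,
      Set.mem_prod, exists_prop]
    constructor
    · rintro ⟨k, hk, l, hl, h1, h2, h3⟩; exact ⟨k, hk, l, ⟨hl, h1, h2⟩, h3⟩
    · rintro ⟨k, hk, l, ⟨hl, h1, h2⟩, h3⟩; exact ⟨k, hk, l, hl, h1, h2, h3⟩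
  rw [this]
  refine Finset.measurableSet_biUnion _ fun k hk => Finset.measurableSet_biUnion _ fun l hl => ?_
  exact (ht.meas k (Finset.mem_range.1 hk)).prod
    (ht.meas l (Finset.mem_range.1 (Finset.mem_filter.1 hl).1))

lemma IsTower.measureReal_biUnion [IsFiniteMeasure ν] (ht : IsTower S B h)
    (hS : MeasurePreserving S ν ν) {K : Finset ℕ} (hK : ∀ k ∈ K, k < h) :
    ν.real (⋃ k ∈ K, floor S B k) = K.card * ν.real B := by
  rw [measureReal_biUnion_finset (fun k hk l hl hkl => ht.disj k (hK k hk) l (hK l hl) hkl)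
    (fun k hk => ht.meas k (hK k hk))]
  simp [measureReal_floor hS]

lemma IsTower.measureReal_towerSet [IsFiniteMeasure ν] (ht : IsTower S B h)
    (hS : MeasurePreserving S ν ν) : ν.real (towerSet S B h) = h * ν.real B := by
  rw [towerSet, ht.measureReal_biUnion hS (fun k hk => Finset.mem_range.1 hk), Finset.card_range]

variable {η : Measure (Z × Z)}

lemma measureReal_floor_prod_floor [IsFiniteMeasure η]
    (hη : MeasurePreserving (Prod.map S S) η η) (a b t : ℕ) :
    η.real (floor S B (a + t) ×ˢ floor S B (b + t)) = η.real (floor S B a ×ˢ floor S B b) := by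
  induction t with
  | zero => rfl
  | succ t ih =>
    have h2 : MeasurePreserving (S.prodCongr S) η η := hη
    rw [← ih, Measure.real, Measure.real, ← h2.measure_preimage_equiv]
    congr 2
    ext ⟨x, y⟩
    exact and_congr mem_floor_succ mem_floor_succ

lemma measureReal_prod_le_of_coupling [IsProbabilityMeasure ν] [IsProbabilityMeasure η]
    (h1 : η.map Prod.fst = ν) (h2 : η.map Prod.snd = ν) {A B A' B' : Set Z}
    (hA : MeasurableSet A) (hA' : MeasurableSet A') (hB : MeasurableSet B)
    (hB' : MeasurableSet B') :
    η.real (A' ×ˢ B') ≤ η.real (A ×ˢ B) + ν.real (A ∆ A') + ν.real (B ∆ B') := by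
  have e1 : ν.real (A ∆ A') = η.real (Prod.fst ⁻¹' (A ∆ A')) := by
    rw [← h1, map_measureReal_apply measurable_fst (hA.symmDiff hA')]
  have e2 : ν.real (B ∆ B') = η.real (Prod.snd ⁻¹' (B ∆ B')) := by
    rw [← h2, map_measureReal_apply measurable_snd (hB.symmDiff hB')]
  rw [e1, e2]
  refine (measureReal_mono (?_ : A' ×ˢ B' ⊆ (A ×ˢ B ∪ Prod.fst ⁻¹' (A ∆ A')) ∪
    Prod.snd ⁻¹' (B ∆ B'))).trans ((measureReal_union_le _ _).trans
      (add_le_add (measureReal_union_le _ _) le_rfl))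
  rintro ⟨x, y⟩ ⟨hx, hy⟩
  by_cases h3 : x ∈ A <;> by_cases h4 : y ∈ B <;> simp_all [Set.mem_symmDiff]

/-- If a coupling `η` gives no mass to finitely many rectangles `A l × A' l` which the tower
resolves, and gives mass at least `δ` to pairs of floors at distance at most `q`, then some graph
of a power of `S` almost avoids these rectangles on all but `q` floors of the tower. -/
theorem exists_iterates_avoiding [IsProbabilityMeasure ν] [IsProbabilityMeasure η]
    (hS : MeasurePreserving S ν ν) (h1 : η.map Prod.fst = ν) (h2 : η.map Prod.snd = ν)
    (hη : MeasurePreserving (Prod.map S S) η η) (ht : IsTower S B h) {q : ℕ}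
    {ι : Type*} [Fintype ι] {A A' : ι → Set Z} {e : ℝ}
    (hA : ∀ l, MeasurableSet (A l)) (hA' : ∀ l, MeasurableSet (A' l))
    (hr : ∀ l, Resolves ν S B h (A l) e) (hr' : ∀ l, Resolves ν S B h (A' l) e)
    (h0 : ∀ l, η (A l ×ˢ A' l) = 0) {δ : ℝ} (hδ : 0 < δ)
    (hD : δ ≤ η.real (nearFloors S B h q)) :
    ∃ a b : ℕ, (h - q) * ν.real B ≤
      ν.real {z ∈ towerSet S B h | ∀ l, ¬ (S^[a] z ∈ A l ∧ S^[b] z ∈ A' l)} +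
        2 * Fintype.card ι * e * (1 + 1 / δ) := by
  classical
  choose C hCm hCs hCe using hr
  choose C' hCm' hCs' hCe' using hr'
  set L : ℝ := (Fintype.card ι : ℝ) with hL
  -- Each pair of floors at distance at most `q` lies on exactly one diagonal `(p.1 + t, p.2 + t)`
  -- with `p ∈ I`. The coupling has the constant weight `w p` along it, and `hit p` records the
  -- places where the diagonal meets a forbidden rectangle.
  set I : Finset (ℕ × ℕ) := (Finset.range h ×ˢ Finset.range h).filter
    (fun p => (p.1 = 0 ∨ p.2 = 0) ∧ p.1 ≤ q ∧ p.2 ≤ q) with hI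
  have memI : ∀ p, p ∈ I ↔ (p.1 < h ∧ p.2 < h) ∧ (p.1 = 0 ∨ p.2 = 0) ∧ p.1 ≤ q ∧ p.2 ≤ q := by
    intro p; simp [hI]
  let len : ℕ × ℕ → ℕ := fun p => h - max p.1 p.2
  let w : ℕ × ℕ → ℝ := fun p => η.real (floor S B p.1 ×ˢ floor S B p.2)
  let hit : ℕ × ℕ → Finset ℕ := fun p => (Finset.range (len p)).filter
    (fun t => ∃ l, floor S B (p.1 + t) ⊆ C l ∧ floor S B (p.2 + t) ⊆ C' l)
  have hitlt : ∀ p, ∀ t ∈ hit p, p.1 + t < h ∧ p.2 + t < h := by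
    intro p t htt
    have := (Finset.mem_filter.1 htt).1
    simp only [len, Finset.mem_range] at this
    omega
  have w0 : ∀ p, 0 ≤ w p := fun p => measureReal_nonneg
  have rect : ∀ l, η.real (C l ×ˢ C' l) ≤ 2 * e := fun l => by
    have := measureReal_prod_le_of_coupling h1 h2 (hA l) (hCm l) (hA' l) (hCm' l)
    rw [Measure.real, Measure.real, h0 l] at this
    have a1 := hCe l
    have a2 := hCe' l
    simp only [Measure.real, ENNReal.toReal_zero] at this a1 a2 ⊢
    linarith
  -- The hit floor rectangles are disjoint and lie inside the saturated approximations of the null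
  -- rectangles, each of mass at most `2 * e`.
  have upper : ∑ p ∈ I, w p * (hit p).card ≤ 2 * L * e := by
    have : ∑ p ∈ I, w p * (hit p).card =
        η.real (⋃ x ∈ I.sigma hit, floor S B (x.1.1 + x.2) ×ˢ floor S B (x.1.2 + x.2)) := by
      rw [measureReal_biUnion_finset]
      · rw [Finset.sum_sigma]
        refine Finset.sum_congr rfl fun p _ => ?_
        simp only [measureReal_floor_prod_floor hη, Finset.sum_const, nsmul_eq_mul]
        exact mul_comm _ _
      · rintro ⟨p, t⟩ hp ⟨p', t'⟩ hp' hne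
        simp only [Finset.coe_sigma, Set.mem_sigma_iff, Finset.mem_coe, memI] at hp hp'
        have b1 := hitlt _ _ hp.2
        have b2 := hitlt _ _ hp'.2
        by_cases c1 : p.1 + t = p'.1 + t'
        · by_cases c2 : p.2 + t = p'.2 + t'
          · exfalso
            apply hne
            have e1 : t = t' := by omega
            subst e1
            have e2 : p = p' := Prod.ext (by omega) (by omega)
            subst e2
            rfl
          · exact Set.disjoint_prod.2 (Or.inr (ht.disj _ b1.2 _ b2.2 c2))
        · exact Set.disjoint_prod.2 (Or.inl (ht.disj _ b1.1 _ b2.1 c1))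
      · rintro ⟨p, t⟩ hp
        have b1 := hitlt _ _ (Finset.mem_sigma.1 hp).2
        exact (ht.meas _ b1.1).prod (ht.meas _ b1.2)
    rw [this]
    calc _ ≤ η.real (⋃ l, C l ×ˢ C' l) := by
            refine measureReal_mono ?_
            intro z hz
            simp only [Set.mem_iUnion] at hz ⊢
            obtain ⟨⟨p, t⟩, hp, hz⟩ := hz
            obtain ⟨l, hl, hl'⟩ := (Finset.mem_filter.1 (Finset.mem_sigma.1 hp).2).2
            exact ⟨l, hl hz.1, hl' hz.2⟩
      _ ≤ ∑ l, η.real (C l ×ˢ C' l) := measureReal_iUnion_fintype_le _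
      _ ≤ ∑ _l : ι, 2 * e := Finset.sum_le_sum fun l _ => rect l
      _ = 2 * L * e := by simp [hL]; ring
  have lower : δ ≤ ∑ p ∈ I, w p * len p := by
    refine hD.trans ?_
    calc _ ≤ η.real (⋃ x ∈ I.sigma (fun p => Finset.range (len p)),
            floor S B (x.1.1 + x.2) ×ˢ floor S B (x.1.2 + x.2)) := by
            refine measureReal_mono ?_ (measure_ne_top _ _)
            rintro z ⟨k, hk, l, hl, hkl, hlk, hz⟩
            simp only [Set.mem_iUnion]
            refine ⟨⟨(k - min k l, l - min k l), min k l⟩, ?_, ?_⟩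
            · simp only [Finset.mem_sigma, memI, Finset.mem_range, len]
              omega
            · have e1 : k - min k l + min k l = k := by omega
              have e2 : l - min k l + min k l = l := by omega
              simp only [e1, e2]
              exact hz
      _ ≤ ∑ x ∈ I.sigma (fun p => Finset.range (len p)),
            η.real (floor S B (x.1.1 + x.2) ×ˢ floor S B (x.1.2 + x.2)) :=
            measureReal_biUnion_finset_le _ _
      _ = _ := by
            rw [Finset.sum_sigma]
            refine Finset.sum_congr rfl fun p _ => ?_
            simp only [measureReal_floor_prod_floor hη, Finset.sum_const, nsmul_eq_mul,
              Finset.card_range]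
            exact mul_comm _ _
  -- Averaging with the weights `w p`: if every diagonal had too large a proportion of hits, `upper`
  -- and `lower` would contradict each other. Strictness comes from a diagonal of positive weight.
  obtain ⟨p, hpI, hp⟩ : ∃ p ∈ I, (hit p).card * δ ≤ 2 * L * e * len p := by
    by_contra! hcon
    have : ∃ p ∈ I, 0 < w p * len p := by
      by_contra! hc
      have := Finset.sum_nonpos hc
      linarith
    obtain ⟨p, hpI, hp⟩ := this
    have wp : 0 < w p := by
      rcases (w0 p).lt_or_eq with h | h
      · exact h
      · rw [← h] at hp; simp at hp
    have e0 : 0 ≤ 2 * L * e := le_trans (Finset.sum_nonneg fun p _ =>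
      mul_nonneg (w0 p) (Nat.cast_nonneg _)) upper
    have : ∑ p ∈ I, w p * (2 * L * e * len p) < ∑ p ∈ I, w p * ((hit p).card * δ) :=
      Finset.sum_lt_sum (fun p hp => mul_le_mul_of_nonneg_left (hcon p hp).le (w0 p))
        ⟨p, hpI, mul_lt_mul_of_pos_left (hcon p hpI) wp⟩
    have e1 : ∑ p ∈ I, w p * (2 * L * e * len p) = 2 * L * e * ∑ p ∈ I, w p * len p := by
      rw [Finset.mul_sum]; exact Finset.sum_congr rfl fun _ _ => by ring
    have e2 : ∑ p ∈ I, w p * ((hit p).card * δ) = δ * ∑ p ∈ I, w p * (hit p).card := by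
      rw [Finset.mul_sum]; exact Finset.sum_congr rfl fun _ _ => by ring
    rw [e1, e2] at this
    have u1 := mul_le_mul_of_nonneg_left upper hδ.le
    have u2 := mul_le_mul_of_nonneg_left lower e0
    linarith
  refine ⟨p.1, p.2, ?_⟩
  rw [memI] at hpI
  set V : Set Z := ⋃ t ∈ Finset.range (len p) \ hit p, floor S B t with hV
  set W : Set Z := {z ∈ towerSet S B h | ∀ l, ¬ (S^[p.1] z ∈ A l ∧ S^[p.2] z ∈ A' l)} with hW
  have Vm : ν.real V = ((len p : ℝ) - (hit p).card) * ν.real B := by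
    rw [hV, ht.measureReal_biUnion hS, Finset.card_sdiff_of_subset (Finset.filter_subset _ _),
      Finset.card_range, Nat.cast_sub]
    · simpa using Finset.card_filter_le (Finset.range (len p)) _
    · intro k hk
      have := (Finset.mem_sdiff.1 hk).1
      simp only [len, Finset.mem_range] at this
      omega
  -- For `z` in an unhit floor `t`, the pair `(S^[p.1] z, S^[p.2] z)` lies in an unhit rectangle of
  -- the diagonal. It can meet `A l × A' l` only where the saturated approximations fail.
  have Vs : V ⊆ W ∪ ⋃ l, (S^[p.1] ⁻¹' (A l ∆ C l) ∪ S^[p.2] ⁻¹' (A' l ∆ C' l)) := by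
    intro z hz
    simp only [hV, Set.mem_iUnion, Finset.mem_sdiff, Finset.mem_range] at hz
    obtain ⟨t, ⟨htl, hth⟩, hzt⟩ := hz
    have htl' : p.1 + t < h ∧ p.2 + t < h := by simp only [len] at htl; omega
    by_cases hzW : z ∈ W
    · exact Or.inl hzW
    right
    simp only [hW, Set.mem_ofPred_eq, not_and, not_forall, not_not] at hzW
    obtain ⟨l, hl⟩ := hzW (mem_towerSet.2 ⟨t, by omega, hzt⟩)
    rw [Set.mem_iUnion]
    refine ⟨l, ?_⟩
    by_contra hcon
    simp only [Set.mem_union, Set.mem_preimage, Set.mem_symmDiff, hl.1, hl.2, true_and,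
      not_true_eq_false, and_false, or_false, not_or, not_not] at hcon
    have f1 : S^[p.1] z ∈ floor S B (p.1 + t) := iterate_mem_floor_add.2 hzt
    have f2 : S^[p.2] z ∈ floor S B (p.2 + t) := iterate_mem_floor_add.2 hzt
    apply hth
    refine Finset.mem_filter.2 ⟨Finset.mem_range.2 htl, l, ?_, ?_⟩
    · exact (hCs l _ htl'.1).resolve_right fun hd => Set.disjoint_left.1 hd f1 hcon.1
    · exact (hCs' l _ htl'.2).resolve_right fun hd => Set.disjoint_left.1 hd f2 hcon.2
  have Vle : ν.real V ≤ ν.real W + 2 * L * e := by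
    refine (measureReal_mono Vs).trans ((measureReal_union_le _ _).trans ?_)
    gcongr
    calc _ ≤ ∑ l, ν.real (S^[p.1] ⁻¹' (A l ∆ C l) ∪ S^[p.2] ⁻¹' (A' l ∆ C' l)) :=
            measureReal_iUnion_fintype_le _
      _ ≤ ∑ _l : ι, (2 * e) := by
            refine Finset.sum_le_sum fun l _ => (measureReal_union_le _ _).trans ?_
            rw [(hS.iterate _).measureReal_preimage ((hA l).symmDiff (hCm l)).nullMeasurableSet,
              (hS.iterate _).measureReal_preimage ((hA' l).symmDiff (hCm' l)).nullMeasurableSet]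
            linarith [hCe l, hCe' l]
      _ = 2 * L * e := by simp [hL]; ring
  have hB0 : 0 ≤ ν.real B := measureReal_nonneg
  have hlen1 : (len p : ℝ) * ν.real B ≤ 1 := by
    have : (len p : ℝ) ≤ h := by exact_mod_cast Nat.sub_le _ _
    calc (len p : ℝ) * ν.real B ≤ h * ν.real B := by gcongr
      _ = ν.real (towerSet S B h) := (ht.measureReal_towerSet hS).symm
      _ ≤ 1 := measureReal_le_one
  have hlen2 : (h : ℝ) - q ≤ len p := by
    have : h ≤ len p + q := by simp only [len]; omega
    have : (h : ℝ) ≤ len p + q := by exact_mod_cast this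
    linarith
  have e0 : 0 ≤ 2 * L * e := le_trans (Finset.sum_nonneg fun p _ =>
      mul_nonneg (w0 p) (Nat.cast_nonneg _)) upper
  have hhit : (hit p).card * ν.real B ≤ 2 * L * e * (1 / δ) := by
    rw [mul_one_div, le_div_iff₀ hδ]
    calc (hit p).card * ν.real B * δ = (hit p).card * δ * ν.real B := by ring
      _ ≤ 2 * L * e * len p * ν.real B := by gcongr
      _ = 2 * L * e * (len p * ν.real B) := by ring
      _ ≤ 2 * L * e := mul_le_of_le_one_right e0 hlen1
  have := mul_le_mul_of_nonneg_right hlen2 hB0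
  rw [Vm] at Vle
  linarith

end Towers

/-! ### Couplings that identify sets. -/

section Agreement

variable {Z : Type*} [MeasurableSpace Z] {ν : Measure Z} {S : Z ≃ᵐ Z} {B : Set Z} {h : ℕ}

lemma Resolves.compl {A : Set Z} {e : ℝ} (hA : Resolves ν S B h A e) :
    Resolves ν S B h Aᶜ e := by
  obtain ⟨A', hm, hs, he⟩ := hA
  refine ⟨A'ᶜ, hm.compl, fun k hk => ?_, by rwa [compl_symmDiff_compl]⟩
  rcases hs k hk with h1 | h1
  · exact Or.inr (Set.disjoint_compl_right_iff_subset.2 h1)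
  · exact Or.inl (Set.subset_compl_iff_disjoint_right.2 h1)

/-- If a coupling `η` identifies the sets `P i` of the first factor with the sets `P' i` of the
second one, then so does, approximately and over a large part of the tower, the graph of some
power of `S`. -/
theorem exists_iterates_agree {η : Measure (Z × Z)} [IsProbabilityMeasure ν]
    [IsProbabilityMeasure η] (hS : MeasurePreserving S ν ν) (h1 : η.map Prod.fst = ν)
    (h2 : η.map Prod.snd = ν) (hη : MeasurePreserving (Prod.map S S) η η)
    (ht : IsTower S B h) {q : ℕ} {ι : Type*} [Fintype ι] {P P' : ι → Set Z} {e : ℝ}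
    (hP : ∀ i, MeasurableSet (P i)) (hP' : ∀ i, MeasurableSet (P' i))
    (hr : ∀ i, Resolves ν S B h (P i) e) (hr' : ∀ i, Resolves ν S B h (P' i) e)
    (h0 : ∀ i, ∀ᵐ p ∂η, (p.1 ∈ P i ↔ p.2 ∈ P' i)) {δ : ℝ} (hδ : 0 < δ)
    (hD : δ ≤ η.real (nearFloors S B h q)) :
    ∃ a b : ℕ, (h - q) * ν.real B ≤
      ν.real {z ∈ towerSet S B h | ∀ i, S^[a] z ∈ P i ↔ S^[b] z ∈ P' i} +
        4 * Fintype.card ι * e * (1 + 1 / δ) := by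
  -- An equivalence fails exactly on the two rectangles `P i × (P' i)ᶜ` and `(P i)ᶜ × P' i`; this
  -- doubles the number of rectangles.
  obtain ⟨a, b, hab⟩ := exists_iterates_avoiding (ι := ι ⊕ ι)
    (A := Sum.elim P fun i => (P i)ᶜ) (A' := Sum.elim (fun i => (P' i)ᶜ) P') (e := e)
    hS h1 h2 hη ht (q := q)
    (by rintro (i | i); exacts [hP i, (hP i).compl])
    (by rintro (i | i); exacts [(hP' i).compl, hP' i])
    (by rintro (i | i); exacts [hr i, (hr i).compl])
    (by rintro (i | i); exacts [(hr' i).compl, hr' i])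
    (by
      rintro (i | i)
      · refine measure_mono_null ?_ (h0 i)
        rintro p ⟨h3, h4⟩ h5
        exact h4 (h5.1 h3)
      · refine measure_mono_null ?_ (h0 i)
        rintro p ⟨h3, h4⟩ h5
        exact h3 (h5.2 h4)) hδ hD
  refine ⟨a, b, hab.trans (le_of_eq ?_)⟩
  congr 1
  · congr 1
    ext z
    simp only [Set.mem_ofPred_eq, Sum.forall, Sum.elim_inl, Sum.elim_inr, Set.mem_compl_iff]
    refine and_congr_right fun _ => ⟨fun h3 i => ⟨fun h4 => ?_, fun h4 => ?_⟩, fun h3 => ?_⟩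
    · by_contra h5; exact h3.1 i ⟨h4, h5⟩
    · by_contra h5; exact h3.2 i ⟨h5, h4⟩
    · exact ⟨fun i h4 => h4.2 ((h3 i).1 h4.1), fun i h4 => h4.1 ((h3 i).2 h4.2)⟩
  · rw [Fintype.card_sum]; push_cast; ring

end Agreement

/-! ### Separating sequences of sets and the diagonal. -/

section Separation

variable {X : Type*} [MeasurableSpace X]

lemma exists_separating_seq (X : Type*) [MeasurableSpace X] [StandardBorelSpace X] :
    ∃ C : ℕ → Set X, (∀ n, MeasurableSet (C n)) ∧
      ∀ x y, (∀ n, x ∈ C n ↔ y ∈ C n) → x = y := by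
  obtain ⟨C, hC, hsep⟩ := exists_seq_separating X (p := MeasurableSet) MeasurableSet.empty Set.univ
  exact ⟨C, hC, fun x y => hsep x trivial y trivial⟩

lemma measurableSet_forall_mem_iff {Z ι : Type*} [MeasurableSpace Z] [Countable ι]
    {P P' : ι → Set Z} (hP : ∀ i, MeasurableSet (P i)) (hP' : ∀ i, MeasurableSet (P' i)) :
    MeasurableSet {z | ∀ i, z ∈ P i ↔ z ∈ P' i} := by
  rw [Set.ofPred_forall]
  exact MeasurableSet.iInter fun i => MeasurableSet.iff (hP i) (hP' i)

/-- These sets decrease to the diagonal because the sequence `C` separates points. Agreement on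
finitely many sets thus serves as a substitute for equality of points. -/
lemma tendsto_measureReal_forall_mem_iff {C : ℕ → Set X} (hC : ∀ n, MeasurableSet (C n))
    (hsep : ∀ x y, (∀ n, x ∈ C n ↔ y ∈ C n) → x = y) (lam : Measure (X × X)) [IsFiniteMeasure lam]
    (h0 : lam (Set.diagonal X) = 0) :
    Tendsto (fun I : ℕ => lam.real {p | ∀ i : Fin I, p.1 ∈ C i ↔ p.2 ∈ C i}) atTop (𝓝 0) := by
  have key := tendsto_measure_iInter_atTop (μ := lam)
    (s := fun I : ℕ => {p : X × X | ∀ i : Fin I, p.1 ∈ C i ↔ p.2 ∈ C i})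
    (fun I => (measurableSet_forall_mem_iff (Z := X × X) (ι := Fin I)
      (P := fun i => Prod.fst ⁻¹' C i) (P' := fun i => Prod.snd ⁻¹' C i)
      (fun i => measurable_fst (hC i)) (fun i => measurable_snd (hC i))).nullMeasurableSet)
    (fun I J hIJ p hp i => hp ⟨i, i.2.trans_le hIJ⟩) ⟨0, measure_ne_top _ _⟩
  have e0 : lam (⋂ I : ℕ, {p : X × X | ∀ i : Fin I, p.1 ∈ C i ↔ p.2 ∈ C i}) = 0 := by
    refine measure_mono_null ?_ h0
    intro p hp
    rw [Set.mem_iInter] at hp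
    exact hsep _ _ fun n => hp (n + 1) ⟨n, n.lt_succ_self⟩
  rw [e0] at key
  exact (ENNReal.tendsto_toReal ENNReal.zero_ne_top).comp key

lemma prod_diagonal_eq_zero [StandardBorelSpace X] (μ : Measure X) [IsProbabilityMeasure μ]
    [NullSingletonClass μ] : (μ.prod μ) (Set.diagonal X) = 0 := by
  rw [Measure.prod_apply measurableSet_diagonal]
  have : ∀ x : X, Prod.mk x ⁻¹' Set.diagonal X = {x} := by
    intro x; ext y; simp [eq_comm]
  simp [this]

end Separation

/-! ### A Ramsey argument for the path coupling. -/

section Coloring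

/-- Attach to each vertex the set of colours of its outgoing increasing edges. Two vertices `k < l`
share this set, so the colour of the edge from `k` to `l` also leaves `l`. -/
lemma exists_monochromatic_path {K : Type*} [Fintype K] {M : ℕ} (hM : 2 ^ Fintype.card K < M)
    (c : Fin M → Fin M → K) : ∃ k l m, k < l ∧ l < m ∧ c k l = c l m := by
  classical
  obtain ⟨k, l, hne, hkl⟩ := Fintype.exists_ne_map_eq_of_card_lt
    (fun k : Fin M => (Finset.univ.filter fun x : K => ∃ l, k < l ∧ c k l = x)) (by simpa using hM)
  wlog hlt : k < l generalizing k l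
  · exact this l k hne.symm hkl.symm (lt_of_le_of_ne (not_lt.1 hlt) hne.symm)
  have : c k l ∈ Finset.univ.filter fun x : K => ∃ m, l < m ∧ c l m = x := by
    rw [← hkl]
    exact Finset.mem_filter.2 ⟨Finset.mem_univ _, l, hlt, rfl⟩
  obtain ⟨m, hm, he⟩ := (Finset.mem_filter.1 this).2
  exact ⟨k, l, m, hlt, hm, he.symm⟩

variable {X : Type*} [MeasurableSpace X]

/-- The distribution of `((x, y), (y, w))` for independent `x`, `y`, `w`. -/
noncomputable def pathCoupling (μ : Measure X) : Measure ((X × X) × (X × X)) :=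
  ((μ.prod μ).prod μ).map fun p => (p.1, (p.1.2, p.2))

lemma measurable_pathMap : Measurable fun p : (X × X) × X => (p.1, (p.1.2, p.2)) := by fun_prop

variable (μ : Measure X) [IsProbabilityMeasure μ]

instance : IsProbabilityMeasure (pathCoupling μ) :=
  Measure.isProbabilityMeasure_map measurable_pathMap.aemeasurable

lemma pathCoupling_map_fst : (pathCoupling μ).map Prod.fst = μ.prod μ := by
  rw [pathCoupling, Measure.map_map measurable_fst measurable_pathMap]
  exact (measurePreserving_fst (μ := μ.prod μ) (ν := μ)).map_eq

lemma pathCoupling_map_snd : (pathCoupling μ).map Prod.snd = μ.prod μ := by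
  rw [pathCoupling, Measure.map_map measurable_snd measurable_pathMap]
  exact ((measurePreserving_snd (μ := μ) (ν := μ)).prod (MeasurePreserving.id μ)).map_eq

lemma measurePreserving_pathCoupling {T : X ≃ᵐ X} (hT : MeasurePreserving T μ μ) :
    MeasurePreserving (Prod.map (T.prodCongr T) (T.prodCongr T)) (pathCoupling μ)
      (pathCoupling μ) := by
  refine ⟨(T.prodCongr T).measurable.prodMap (T.prodCongr T).measurable, ?_⟩
  rw [pathCoupling, Measure.map_map ((T.prodCongr T).measurable.prodMap
    (T.prodCongr T).measurable) measurable_pathMap]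
  conv_rhs => rw [← ((hT.prod hT).prod hT).map_eq, Measure.map_map measurable_pathMap
    ((hT.prod hT).prod hT).measurable]
  rfl

/-- Among independent points, pairs `(x, y)`, `(y, w)` have the same colour with a probability
bounded below in terms of the number of colours. -/
lemma exists_pathCoupling_mass {K : Type*} [Fintype K] {M : ℕ} (hM : 2 ^ Fintype.card K < M)
    {E : Set ((X × X) × (X × X))} (hE : MeasurableSet E) (c : X × X → K)
    (hc : ∀ p p', c p = c p' → (p, p') ∈ E) : 1 / (M : ℝ) ^ 3 ≤ (pathCoupling μ).real E := by
  classical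
  set Pr := Measure.pi fun _ : Fin M => μ
  let f : Fin M × Fin M × Fin M → (Fin M → X) → (X × X) × X :=
    fun t ω => ((ω t.1, ω t.2.1), ω t.2.2)
  have law : ∀ t : Fin M × Fin M × Fin M, t.1 < t.2.1 → t.2.1 < t.2.2 →
      Pr.map (f t) = (μ.prod μ).prod μ := by
    intro t h1 h2
    have ind : ProbabilityTheory.iIndepFun (fun i (ω : Fin M → X) => ω i) Pr :=
      ProbabilityTheory.iIndepFun_pi (X := fun _ x => x) fun _ => aemeasurable_id
    have i1 := ind.indepFun_prodMk (fun i => measurable_pi_apply i) t.1 t.2.1 t.2.2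
      (h1.trans h2).ne h2.ne
    have i2 := ind.indepFun h1.ne
    have am : ∀ i, AEMeasurable (fun ω : Fin M → X => ω i) Pr := fun i =>
      (measurable_pi_apply i).aemeasurable
    rw [ProbabilityTheory.indepFun_iff_map_prod_eq_prod_map_map (am _) (am _)] at i2
    rw [ProbabilityTheory.indepFun_iff_map_prod_eq_prod_map_map ((am _).prodMk (am _)) (am _)] at i1
    have ev : ∀ i, Pr.map (fun ω => ω i) = μ := fun i =>
      (measurePreserving_eval (fun _ : Fin M => μ) i).map_eq
    rw [i2, ev, ev, ev] at i1
    exact i1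
  let E0 : Set ((X × X) × X) := (fun p => (p.1, (p.1.2, p.2))) ⁻¹' E
  have hE0 : MeasurableSet E0 := measurable_pathMap hE
  have hval : (pathCoupling μ).real E = ((μ.prod μ).prod μ).real E0 :=
    map_measureReal_apply measurable_pathMap hE
  set J : Finset (Fin M × Fin M × Fin M) :=
    Finset.univ.filter fun t => t.1 < t.2.1 ∧ t.2.1 < t.2.2
  -- Any `M` points contain a monochromatic path, and every increasing triple of the independent
  -- points has the law of the path coupling. So one of at most `M ^ 3` events of equal probability
  -- always occurs.
  have cover : (Set.univ : Set (Fin M → X)) ⊆ ⋃ t ∈ J, f t ⁻¹' E0 := by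
    intro ω _
    obtain ⟨k, l, m, hkl, hlm, he⟩ := exists_monochromatic_path hM fun k l => c (ω k, ω l)
    simp only [Set.mem_iUnion]
    exact ⟨(k, l, m), by simp [J, hkl, hlm], hc _ _ he⟩
  have hfm : ∀ t, Measurable (f t) := fun t => by fun_prop
  have h1 : (1 : ℝ) ≤ J.card * (pathCoupling μ).real E := by
    calc (1 : ℝ) = Pr.real Set.univ := by simp [Pr]
      _ ≤ Pr.real (⋃ t ∈ J, f t ⁻¹' E0) := measureReal_mono cover (measure_ne_top _ _)
      _ ≤ ∑ t ∈ J, Pr.real (f t ⁻¹' E0) := measureReal_biUnion_finset_le _ _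
      _ = ∑ t ∈ J, (pathCoupling μ).real E := Finset.sum_congr rfl fun t ht => by
          have := (Finset.mem_filter.1 ht).2
          rw [hval, ← law t this.1 this.2, map_measureReal_apply (hfm t) hE0]
      _ = _ := by simp
  have hcard : (J.card : ℝ) ≤ (M : ℝ) ^ 3 := by
    have : J.card ≤ M ^ 3 := (Finset.card_le_univ _).trans (by simp; ring_nf; rfl)
    exact_mod_cast this
  have hMpos : (0 : ℝ) < M := by exact_mod_cast (Nat.zero_le _).trans_lt hM
  rw [div_le_iff₀' (by positivity)]
  exact h1.trans (by gcongr)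

end Coloring

/-! ### Towers inside approximating partitions. -/

section Partitions

variable {Z : Type*} [MeasurableSpace Z] {S : Z ≃ᵐ Z} {B : Set Z} {h : ℕ}

lemma IsMeasurablePartition.isTower {ι : Type*} {P : ι → Set Z} (hP : IsMeasurablePartition P)
    {u : ∀ k < h, ι} (hu : ∀ k hk, P (u k hk) = floor S B k)
    (hinj : ∀ k hk l hl, u k hk = u l hl → k = l) : IsTower S B h where
  meas k hk := hu k hk ▸ hP.1 _
  disj k hk l hl hkl := by
    rw [← hu k hk, ← hu l hl]
    exact hP.2.1 fun he => hkl (hinj _ _ _ _ he)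

lemma IsMeasurablePartition.saturated_biUnion {ι : Type*} {P : ι → Set Z}
    (hP : IsMeasurablePartition P) {u : ∀ k < h, ι} (hu : ∀ k hk, P (u k hk) = floor S B k)
    (F : Set ι) : Saturated S B h (⋃ i ∈ F, P i) := by
  intro k hk
  rw [← hu k hk]
  by_cases hF : u k hk ∈ F
  · exact Or.inl (Set.subset_biUnion_of_mem (u := P) hF)
  · refine Or.inr ?_
    rw [Set.disjoint_iUnion₂_right]
    exact fun i hi => hP.2.1 fun he => hF (he ▸ hi)

lemma TendsToPoints.eventually_approx {ν : Measure Z} [IsFiniteMeasure ν] {ι : ℕ → Type*}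
    [∀ j, Countable (ι j)] {ξ : ∀ j, ι j → Set Z} (hξ : TendsToPoints ν ξ)
    (hP : ∀ j, IsMeasurablePartition (ξ j)) {A : Set Z} (hA : MeasurableSet A) {e : ℝ}
    (he : 0 < e) : ∀ᶠ j in atTop, ∃ F : Set (ι j), MeasurableSet (⋃ i ∈ F, ξ j i) ∧
      ν.real (A ∆ ⋃ i ∈ F, ξ j i) ≤ e := by
  obtain ⟨F, hF⟩ := hξ A hA
  have h1 := (ENNReal.tendsto_toReal ENNReal.zero_ne_top).comp hF
  filter_upwards [h1.eventually (ge_mem_nhds (by simpa using he))] with j hj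
  exact ⟨F j, MeasurableSet.biUnion (Set.to_countable _) fun i _ => (hP j).1 i, hj⟩

end Partitions

/-! ### The rank of `T × T` is infinite. -/

section Rank

lemma le_add_of_div_succ_eq {a b q : ℕ} (hab : a / (q + 1) = b / (q + 1)) : a ≤ b + q := by
  have h1 := Nat.div_add_mod a (q + 1)
  have h2 := Nat.mod_lt a (Nat.succ_pos q)
  have h3 := Nat.mul_div_le b (q + 1)
  rw [hab] at h1
  have h4 : a % (q + 1) ≤ q := Nat.lt_succ_iff.1 h2
  omega

variable {X : Type*} [MeasurableSpace X] {μ : Measure X} [IsProbabilityMeasure μ]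

lemma iterate_prodCongr (T : X ≃ᵐ X) (n : ℕ) (z : X × X) :
    (T.prodCongr T)^[n] z = (T^[n] z.1, T^[n] z.2) := by
  have : (⇑(T.prodCongr T) : X × X → X × X) = Prod.map T T := rfl
  rw [this, Prod.map_iterate]; rfl

lemma measurePreserving_prodCongr {T : X ≃ᵐ X} (hT : MeasurePreserving T μ μ) :
    MeasurePreserving (T.prodCongr T) (μ.prod μ) (μ.prod μ) := hT.prod hT

/-- The map `(x, y) ↦ (T^a y, T^b x)` preserves `μ ⊗ μ`, so the unknown exponents play no role in
the final estimate. -/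
lemma measureReal_iterate_agree {T : X ≃ᵐ X} (hT : MeasurePreserving T μ μ) {ι : Type*}
    [Countable ι] {C : ι → Set X} (hC : ∀ i, MeasurableSet (C i)) (a b : ℕ) :
    (μ.prod μ).real {z | ∀ i, T^[a] z.2 ∈ C i ↔ T^[b] z.1 ∈ C i} =
      (μ.prod μ).real {z | ∀ i, z.1 ∈ C i ↔ z.2 ∈ C i} := by
  have h1 : MeasurePreserving (fun z : X × X => (T^[a] z.2, T^[b] z.1)) (μ.prod μ) (μ.prod μ) :=
    ((hT.iterate a).prod (hT.iterate b)).comp Measure.measurePreserving_swap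
  exact h1.measureReal_preimage (measurableSet_forall_mem_iff (Z := X × X)
      (P := fun i => Prod.fst ⁻¹' C i) (P' := fun i => Prod.snd ⁻¹' C i)
      (fun i => measurable_fst (hC i)) (fun i => measurable_snd (hC i))).nullMeasurableSet

/-- Finitely many towers of `T × T` covering the whole space cannot resolve many sets. -/
lemma lower_bound_agree_of_towers {T : X ≃ᵐ X} (hT : MeasurePreserving T μ μ)
    {K : Type*} [Fintype K] {M : ℕ} (hM : 2 ^ Fintype.card (K × Fin 2) < M)
    {B : K → Set (X × X)} {h : K → ℕ} (ht : ∀ i, IsTower (T.prodCongr T) (B i) (h i))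
    (hcov : ∀ z, ∃ i, z ∈ towerSet (T.prodCongr T) (B i) (h i))
    {ι : Type*} [Fintype ι] {C : ι → Set X} (hC : ∀ i, MeasurableSet (C i)) {e : ℝ}
    (hr : ∀ k i, Resolves (μ.prod μ) (T.prodCongr T) (B k) (h k) (Prod.snd ⁻¹' C i) e)
    (hr' : ∀ k i, Resolves (μ.prod μ) (T.prodCongr T) (B k) (h k) (Prod.fst ⁻¹' C i) e)
    {δ : ℝ} (hδ : δ = 1 / ((M : ℝ) ^ 3 * Fintype.card K)) :
    δ / 2 ≤ (μ.prod μ).real {z | ∀ i, z.1 ∈ C i ↔ z.2 ∈ C i} +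
      4 * Fintype.card ι * e * (1 + 1 / δ) := by
  classical
  let S := T.prodCongr T
  have hS : MeasurePreserving S (μ.prod μ) (μ.prod μ) := measurePreserving_prodCongr hT
  let D : K → Set ((X × X) × (X × X)) := fun i => nearFloors S (B i) (h i) (h i / 2)
  have hDm : ∀ i, MeasurableSet (D i) := fun i => (ht i).measurableSet_nearFloors _
  choose i0 hi0 using hcov
  choose k0 hk0 hz0 using fun z => mem_towerSet.1 (hi0 z)
  -- The colour of a point is its tower together with one of two blocks of `h / 2 + 1` floors. Equal
  -- colours force a distance of at most `h / 2`.
  let c : X × X → K × Fin 2 := fun z => (i0 z, ⟨k0 z / (h (i0 z) / 2 + 1), by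
    rw [Nat.div_lt_iff_lt_mul (Nat.succ_pos _)]
    have := hk0 z
    omega⟩)
  have key := exists_pathCoupling_mass μ hM (MeasurableSet.iUnion hDm) c (by
    intro p p' hpp
    have e1 : i0 p = i0 p' := congrArg Prod.fst hpp
    have e2 : k0 p / (h (i0 p) / 2 + 1) = k0 p' / (h (i0 p') / 2 + 1) :=
      congrArg (fun x => (Prod.snd x).val) hpp
    have a1 := hk0 p
    have a2 := hk0 p'
    have a3 := hz0 p
    have a4 := hz0 p'
    rw [← e1] at a2 a4 e2
    refine Set.mem_iUnion.2 ⟨i0 p, k0 p, a1, k0 p', a2, ?_, ?_, a3, a4⟩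
    · exact le_add_of_div_succ_eq e2
    · exact le_add_of_div_succ_eq e2.symm)
  have hMpos : (0 : ℝ) < M := by exact_mod_cast (Nat.zero_le _).trans_lt hM
  have : Nonempty X := by
    by_contra hne
    rw [not_nonempty_iff] at hne
    have := measure_univ (μ := μ)
    rw [Set.univ_eq_empty_iff.2 hne] at this
    simp at this
  have : Nonempty K := ⟨i0 (Classical.arbitrary _)⟩
  have hKpos : (0 : ℝ) < Fintype.card K := by exact_mod_cast Fintype.card_pos
  have hδ0 : 0 < δ := by rw [hδ]; positivity
  obtain ⟨i, hi⟩ : ∃ i, δ ≤ (pathCoupling μ).real (D i) := by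
    by_contra! hcon
    have h1 := key.trans (measureReal_iUnion_fintype_le D)
    have h2 : ∑ i, (pathCoupling μ).real (D i) < ∑ _i : K, δ :=
      Finset.sum_lt_sum_of_nonempty Finset.univ_nonempty fun i _ => hcon i
    have h3 : ∑ _i : K, δ = 1 / (M : ℝ) ^ 3 := by
      rw [Finset.sum_const, Finset.card_univ, nsmul_eq_mul, hδ]
      field_simp
    linarith
  obtain ⟨a, b, hab⟩ := exists_iterates_agree hS (pathCoupling_map_fst μ) (pathCoupling_map_snd μ)
    (measurePreserving_pathCoupling μ hT) (ht i) (q := h i / 2) (e := e)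
    (fun l => measurable_snd (hC l)) (fun l => measurable_fst (hC l)) (hr i) (hr' i)
    (fun l => by
      have hm : MeasurableSet {p : (X × X) × X × X |
          p.1 ∈ Prod.snd ⁻¹' C l ↔ p.2 ∈ Prod.fst ⁻¹' C l} :=
        MeasurableSet.iff (measurable_fst (measurable_snd (hC l)))
          (measurable_snd (measurable_fst (hC l)))
      rw [pathCoupling, ae_map_iff measurable_pathMap.aemeasurable hm]
      exact Eventually.of_forall fun p => Iff.rfl) hδ0 hi
  refine le_trans ?_ (hab.trans ?_)
  -- The near pairs project into the tower, so the tower has measure at least `δ`. Losing `h / 2`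
  -- floors leaves at least half of it.
  · have h1 : δ ≤ h i * (μ.prod μ).real (B i) := by
      rw [← (ht i).measureReal_towerSet hS, ← pathCoupling_map_fst μ,
        map_measureReal_apply measurable_fst (ht i).measurableSet_towerSet]
      refine hi.trans (measureReal_mono ?_ (measure_ne_top _ _))
      rintro p ⟨k, hk, l, hl, -, -, h1, -⟩
      exact mem_towerSet.2 ⟨k, hk, h1⟩
    have h2 : ((h i / 2 : ℕ) : ℝ) ≤ h i / 2 := Nat.cast_div_le
    have h3 : 0 ≤ (μ.prod μ).real (B i) := measureReal_nonneg
    nlinarith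
  · rw [← measureReal_iterate_agree hT hC a b]
    refine add_le_add ?_ le_rfl
    refine measureReal_mono ?_ (measure_ne_top _ _)
    rintro z ⟨-, hz⟩ l
    have := hz l
    rwa [iterate_prodCongr, iterate_prodCongr] at this

theorem not_hasTowers_prodCongr [StandardBorelSpace X] [NullSingletonClass μ] {T : X ≃ᵐ X}
    (hT : MeasurePreserving T μ μ) (r : ℕ) : ¬ HasTowers (T.prodCongr T) (μ.prod μ) r := by
  rintro ⟨h, B, Y, ξ, hξ, hP, hlim⟩
  obtain ⟨C, hC, hsep⟩ := exists_separating_seq X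
  -- The remainder `Y j` counts as one more tower, of height `1`, so that the towers cover the whole
  -- space.
  let K := Option (Fin r)
  let M : ℕ := 2 ^ Fintype.card (K × Fin 2) + 1
  set δ : ℝ := 1 / ((M : ℝ) ^ 3 * Fintype.card K) with hδ
  have hδ0 : 0 < δ := by
    have : 0 < Fintype.card K := Fintype.card_pos
    have : 0 < M := Nat.succ_pos _
    positivity
  obtain ⟨I, hI⟩ := ((tendsto_measureReal_forall_mem_iff hC hsep (μ.prod μ)
    (prod_diagonal_eq_zero μ)).eventually (gt_mem_nhds (show (0 : ℝ) < δ / 4 by positivity))).exists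
  obtain ⟨e, he0, he⟩ : ∃ e : ℝ, 0 < e ∧ 4 * I * e * (1 + 1 / δ) ≤ δ / 8 := by
    refine ⟨δ / (8 * (4 * I * (1 + 1 / δ) + 1)), by positivity, ?_⟩
    rw [show 4 * I * (δ / (8 * (4 * I * (1 + 1 / δ) + 1))) * (1 + 1 / δ) =
      δ / 8 * ((4 * I * (1 + 1 / δ)) / (4 * I * (1 + 1 / δ) + 1)) by field_simp]
    refine mul_le_of_le_one_right (by positivity) ?_
    rw [div_le_one (by positivity)]
    linarith
  have ev : ∀ A : Set (X × X), MeasurableSet A → ∀ᶠ j in atTop, ∀ k : K,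
      Resolves (μ.prod μ) (T.prodCongr T) (k.elim (Y j) (B j)) (k.elim 1 fun i => h j i + 1) A e := by
    intro A hA
    filter_upwards [hlim.eventually_approx hP hA he0] with j hj k
    obtain ⟨F, hF, hFe⟩ := hj
    refine ⟨_, hF, ?_, hFe⟩
    cases k with
    | none =>
      refine (hP j).saturated_biUnion (u := fun _ _ => Sum.inr ()) ?_ F
      intro k hk
      obtain rfl : k = 0 := Nat.lt_one_iff.1 hk
      simp [hξ]
    | some i =>
      refine (hP j).saturated_biUnion (u := fun k hk => Sum.inl ⟨i, ⟨k, hk⟩⟩) ?_ F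
      intro k hk
      simp [hξ]
  have tow : ∀ j, ∀ k : K,
      IsTower (T.prodCongr T) (k.elim (Y j) (B j)) (k.elim 1 fun i => h j i + 1) := by
    intro j k
    cases k with
    | none =>
      refine (hP j).isTower (u := fun _ _ => Sum.inr ()) ?_ ?_
      · intro k hk
        obtain rfl : k = 0 := Nat.lt_one_iff.1 hk
        simp [hξ]
      · intro k hk l hl _
        exact (Nat.lt_one_iff.1 hk).trans (Nat.lt_one_iff.1 hl).symm
    | some i =>
      refine (hP j).isTower (u := fun k hk => Sum.inl ⟨i, ⟨k, hk⟩⟩) ?_ ?_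
      · intro k hk
        simp [hξ]
      · intro k hk l hl hkl
        have h1 := Sum.inl_injective hkl
        exact congrArg Fin.val (eq_of_heq (Sigma.mk.inj h1).2)
  have ev1 : ∀ᶠ j in atTop, ∀ i : Fin I, ∀ k : K, Resolves (μ.prod μ) (T.prodCongr T)
      (k.elim (Y j) (B j)) (k.elim 1 fun i => h j i + 1) (Prod.snd ⁻¹' C i) e :=
    eventually_all.2 fun i => ev _ (measurable_snd (hC i))
  have ev2 : ∀ᶠ j in atTop, ∀ i : Fin I, ∀ k : K, Resolves (μ.prod μ) (T.prodCongr T)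
      (k.elim (Y j) (B j)) (k.elim 1 fun i => h j i + 1) (Prod.fst ⁻¹' C i) e :=
    eventually_all.2 fun i => ev _ (measurable_fst (hC i))
  obtain ⟨j, hj1, hj2⟩ := (ev1.and ev2).exists
  have := lower_bound_agree_of_towers hT (M := M) (Nat.lt_succ_self _) (tow j) (by
    intro z
    have hz : z ∈ ⋃ i, ξ j i := (hP j).2.2 ▸ Set.mem_univ z
    obtain ⟨p, hp⟩ := Set.mem_iUnion.1 hz
    rw [hξ] at hp
    rcases p with ⟨i, k⟩ | u
    · exact ⟨some i, mem_towerSet.2 ⟨k, k.2, hp⟩⟩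
    · exact ⟨none, mem_towerSet.2 ⟨0, Nat.one_pos, by simpa using hp⟩⟩)
    (fun i : Fin I => hC i) (fun k i => hj1 i k) (fun k i => hj2 i k) hδ
  rw [Fintype.card_fin] at this
  linarith

theorem rank_prodCongr_eq_top [StandardBorelSpace X] [NullSingletonClass μ] {T : X ≃ᵐ X}
    (hT : MeasurePreserving T μ μ) : rank (T.prodCongr T) (μ.prod μ) = ⊤ := by
  simp only [rank, iInf_eq_top]
  exact fun r hr => absurd hr (not_hasTowers_prodCongr hT r)

end Rank

/-! ### Towers of the local rank and invariant sets. -/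

section LocalTowers

variable {Z : Type*} [MeasurableSpace Z] {S : Z ≃ᵐ Z} {ν : Measure Z}

/-- A sequence of towers of limit measure `β` which resolves every measurable set. -/
structure LocalTowers (S : Z ≃ᵐ Z) (ν : Measure Z) (B : ℕ → Set Z) (h : ℕ → ℕ) (β : ℝ) :
    Prop where
  tower : ∀ j, IsTower S (B j) (h j)
  resolves : ∀ A, MeasurableSet A → ∀ e > 0, ∀ᶠ j in atTop, Resolves ν S (B j) (h j) A e
  tendsto : Tendsto (fun j => ν.real (towerSet S (B j) (h j))) atTop (𝓝 β)

lemma HasLocalTowers.exists_localTowers [IsProbabilityMeasure ν] {b : ℝ≥0∞}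
    (hb : HasLocalTowers S ν b) : b ≠ ⊤ ∧ ∃ B h, LocalTowers S ν B h b.toReal := by
  obtain ⟨h, m, B, C, ξ, hξ, hP, hlim, ht⟩ := hb
  have hb : b ≠ ⊤ := ((le_of_tendsto' ht fun j => prob_le_one).trans_lt ENNReal.one_lt_top).ne
  refine ⟨hb, B, h, fun j => ?_, fun A hA e he => ?_, ?_⟩
  · refine (hP j).isTower (u := fun k hk => Sum.inl ⟨k, hk⟩) (fun k hk => by simp [hξ]) ?_
    intro k hk l hl hkl
    exact congrArg Fin.val (Sum.inl_injective hkl)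
  · filter_upwards [hlim.eventually_approx hP hA he] with j ⟨F, hF, hFe⟩
    exact ⟨_, hF, (hP j).saturated_biUnion (u := fun k hk => Sum.inl ⟨k, hk⟩)
      (fun k hk => by simp [hξ]) F, hFe⟩
  · refine ((ENNReal.tendsto_toReal hb).comp ht).congr fun j => ?_
    simp only [Function.comp, Measure.real, towerSet]
    congr 2
    ext z
    simp only [Set.mem_iUnion, Finset.mem_range, exists_prop]
    exact ⟨fun ⟨k, hk⟩ => ⟨k, k.2, hk⟩, fun ⟨k, hk, hz⟩ => ⟨⟨k, hk⟩, hz⟩⟩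

/-- A tower resolving an invariant set lies almost inside or almost outside of it. -/
lemma IsTower.dichotomy [IsProbabilityMeasure ν] (hS : MeasurePreserving S ν ν) {B : Set Z}
    {h : ℕ} (ht : IsTower S B h) {A : Set Z} (hA : MeasurableSet A) (hinv : S ⁻¹' A = A) {e : ℝ}
    (hr : Resolves ν S B h A e) :
    ν.real (towerSet S B h ∩ A) ≤ e ∨ ν.real (towerSet S B h \ A) ≤ e := by
  classical
  have sub : ∀ {E : Set Z}, MeasurableSet E → S ⁻¹' E = E →
      (∀ k, floor S B k ∩ E = floor S (B ∩ E) k) ∧ IsTower S (B ∩ E) h ∧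
      towerSet S B h ∩ E = towerSet S (B ∩ E) h := by
    intro E hE hEi
    have h1 : ∀ k, floor S B k ∩ E = floor S (B ∩ E) k := by
      intro k
      have h2 : S^[k] ⁻¹' E = E := by
        induction k with
        | zero => rfl
        | succ k ih => rw [Function.iterate_succ, Set.preimage_comp, ih, hEi]
      unfold floor
      conv_rhs => rw [← h2, Set.image_inter_preimage]
    refine ⟨h1, ⟨fun k hk => h1 k ▸ (ht.meas k hk).inter hE, fun k hk l hl hkl => ?_⟩, ?_⟩
    · rw [← h1, ← h1]
      exact (ht.disj k hk l hl hkl).mono Set.inter_subset_left Set.inter_subset_left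
    · simp only [towerSet, Set.iUnion_inter, h1]
  obtain ⟨s1, s2, s3⟩ := sub hA hinv
  obtain ⟨c1, c2, c3⟩ := sub hA.compl (by rw [Set.preimage_compl, hinv])
  obtain ⟨C, hC, hCs, hCe⟩ := hr
  rw [Set.sdiff_eq, s3, c3, s2.measureReal_towerSet hS, c2.measureReal_towerSet hS]
  set α := ν.real (B ∩ A) with hα
  set γ := ν.real (B ∩ Aᶜ) with hγ
  -- An invariant set cuts all floors in the same proportion `α : γ`, whereas `C` contains each
  -- floor or misses it. Hence `C` is wrong on a part `W k` of every floor, of measure at least `min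
  -- α γ`.
  let W : ℕ → Set Z := fun k => if floor S B k ⊆ C then floor S (B ∩ Aᶜ) k else floor S (B ∩ A) k
  have Wsub : ∀ k, W k ⊆ floor S B k := by
    intro k
    simp only [W]
    split_ifs
    · rw [← c1]; exact Set.inter_subset_left
    · rw [← s1]; exact Set.inter_subset_left
  have Wm : ∀ k < h, MeasurableSet (W k) := by
    intro k hk
    simp only [W]
    split_ifs
    exacts [c2.meas k hk, s2.meas k hk]
  have Wval : ∀ k, min α γ ≤ ν.real (W k) := by
    intro k
    simp only [W]
    split_ifs
    · rw [measureReal_floor hS]; exact min_le_right _ _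
    · rw [measureReal_floor hS]; exact min_le_left _ _
  have key : h * min α γ ≤ e := by
    calc h * min α γ = ∑ _k ∈ Finset.range h, min α γ := by simp
      _ ≤ ∑ k ∈ Finset.range h, ν.real (W k) := Finset.sum_le_sum fun k _ => Wval k
      _ = ν.real (⋃ k ∈ Finset.range h, W k) := by
          rw [measureReal_biUnion_finset]
          · intro k hk l hl hkl
            exact (ht.disj k (by simpa using hk) l (by simpa using hl) hkl).mono (Wsub k) (Wsub l)
          · exact fun k hk => Wm k (Finset.mem_range.1 hk)
      _ ≤ ν.real (A ∆ C) := by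
          refine measureReal_mono ?_ (measure_ne_top _ _)
          intro z hz
          simp only [Set.mem_iUnion, Finset.mem_range] at hz
          obtain ⟨k, hk, hz⟩ := hz
          simp only [W] at hz
          split_ifs at hz with hkC
          · rw [← c1] at hz
            exact Or.inr ⟨hkC hz.1, hz.2⟩
          · rw [← s1] at hz
            exact Or.inl ⟨hz.2, fun hzC =>
              Set.disjoint_left.1 ((hCs k hk).resolve_left hkC) hz.1 hzC⟩
      _ ≤ e := hCe
  rcases min_choice α γ with h1 | h1 <;> rw [h1] at key
  exacts [Or.inl key, Or.inr key]

/-- A tower of height at least `2 n` contains no points of period at most `n`. -/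
lemma IsTower.iterate_ne_self {B : Set Z} {h n : ℕ} (ht : IsTower S B h) (hn : 2 * n ≤ h) {z : Z}
    (hz : z ∈ towerSet S B h) {m : ℕ} (hm : 0 < m) (hmn : m ≤ n) : S^[m] z ≠ z := by
  intro he
  obtain ⟨k, hk, hzk⟩ := mem_towerSet.1 hz
  by_cases hkm : m + k < h
  · have h1 : S^[m] z ∈ floor S B (m + k) := iterate_mem_floor_add.2 hzk
    rw [he] at h1
    exact Set.disjoint_left.1 (ht.disj _ hkm _ hk (by omega)) h1 hzk
  -- Near the top one compares with a lower floor: here `k ≥ h - m ≥ m`, because `2 * n ≤ h`.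
  · have h1 : S^[m] z ∈ floor S B (m + (k - m)) := by
      rw [he, Nat.add_sub_cancel' (by omega)]; exact hzk
    exact Set.disjoint_left.1 (ht.disj _ hk _ (by omega) (by omega)) hzk
      (iterate_mem_floor_add.1 h1)

end LocalTowers

/-! ### Towers and periodic points. -/

section Periodic

variable {X : Type*} [MeasurableSpace X] [StandardBorelSpace X] {μ : Measure X}
  [IsProbabilityMeasure μ] {T : X ≃ᵐ X} {B : ℕ → Set (X × X)} {h : ℕ → ℕ} {β : ℝ}

/-- Up to a small error the base lies over a single atom `E` of the partition of `X` generated by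
finitely many separating sets. Such an atom is small because `E × E` lies in a small neighbourhood
of the diagonal. -/
lemma LocalTowers.eventually_base_le [NullSingletonClass μ]
    (hL : LocalTowers (T.prodCongr T) (μ.prod μ) B h β) {ε : ℝ} (hε : 0 < ε) :
    ∀ᶠ j in atTop, 0 < h j → (μ.prod μ).real (B j) ≤ ε := by
  obtain ⟨C, hC, hsep⟩ := exists_separating_seq X
  obtain ⟨I, hI⟩ := ((tendsto_measureReal_forall_mem_iff hC hsep (μ.prod μ)
    (prod_diagonal_eq_zero μ)).eventually
      (gt_mem_nhds (show (0 : ℝ) < (ε / 2) ^ 2 by positivity))).exists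
  have ev : ∀ᶠ j in atTop, ∀ i : Fin I, Resolves (μ.prod μ) (T.prodCongr T) (B j) (h j)
      (Prod.fst ⁻¹' C i) (ε / (2 * (I + 1))) :=
    eventually_all.2 fun i => hL.resolves _ (measurable_fst (hC i)) _ (by positivity)
  filter_upwards [ev] with j hj hpos
  choose A hAm hAs hAe using hj
  let E : Set X := {x | ∀ i : Fin I, x ∈ C i ↔ B j ⊆ A i}
  have hE : (μ.prod μ).real (E ×ˢ E) < (ε / 2) ^ 2 := by
    refine lt_of_le_of_lt (measureReal_mono ?_ (measure_ne_top _ _)) hI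
    rintro ⟨x, y⟩ ⟨hx, hy⟩ i
    exact (hx i).trans (hy i).symm
  have hE' : μ.real E ≤ ε / 2 := by
    rw [measureReal_prod_prod, ← sq] at hE
    exact (lt_of_pow_lt_pow_left₀ 2 (by positivity) hE).le
  have hsub : B j ⊆ (Prod.fst ⁻¹' E) ∪ ⋃ i : Fin I, (Prod.fst ⁻¹' C i) ∆ A i := by
    intro z hz
    by_cases hzE : z.1 ∈ E
    · exact Or.inl hzE
    right
    simp only [E, Set.mem_ofPred_eq, not_forall] at hzE
    obtain ⟨i, hi⟩ := hzE
    refine Set.mem_iUnion.2 ⟨i, ?_⟩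
    have h0 := hAs i 0 hpos
    rw [floor_zero] at h0
    rcases h0 with h0 | h0
    · exact Or.inr ⟨h0 hz, fun hc => hi ⟨fun _ => h0, fun _ => hc⟩⟩
    · refine Or.inl ⟨?_, fun hzA => Set.disjoint_left.1 h0 hz hzA⟩
      by_contra hc
      exact hi ⟨fun h1 => absurd h1 hc,
        fun h1 => absurd (h1 hz) fun hzA => Set.disjoint_left.1 h0 hz hzA⟩
  have hfst : (μ.prod μ).real (Prod.fst ⁻¹' E) = μ.real E := by
    rw [← Set.prod_univ, measureReal_prod_prod]; simp
  calc (μ.prod μ).real (B j) ≤ (μ.prod μ).real (Prod.fst ⁻¹' E) +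
        ∑ i : Fin I, (μ.prod μ).real ((Prod.fst ⁻¹' C i) ∆ A i) :=
          (measureReal_mono hsub (measure_ne_top _ _)).trans ((measureReal_union_le _ _).trans
            (add_le_add le_rfl (measureReal_iUnion_fintype_le _)))
    _ ≤ ε / 2 + ∑ _i : Fin I, ε / (2 * (I + 1)) := by
          rw [hfst]
          exact add_le_add hE' (Finset.sum_le_sum fun i _ => hAe i)
    _ ≤ ε := by
          have : (I : ℝ) * (ε / (2 * (I + 1))) ≤ ε / 2 := by
            rw [show (I : ℝ) * (ε / (2 * (I + 1))) = ε / 2 * (I / (I + 1)) by field_simp]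
            refine mul_le_of_le_one_right (by positivity) ?_
            rw [div_le_one (by positivity)]
            linarith
          simp only [Finset.sum_const, Finset.card_univ, Fintype.card_fin, nsmul_eq_mul]
          linarith

/-- Height times base measure tends to `β > 0` while the base becomes small. -/
lemma LocalTowers.eventually_le_height [NullSingletonClass μ] (hT : MeasurePreserving T μ μ)
    (hL : LocalTowers (T.prodCongr T) (μ.prod μ) B h β) (hβ : 0 < β) (n : ℕ) :
    ∀ᶠ j in atTop, n ≤ h j := by
  filter_upwards [hL.eventually_base_le (show (0 : ℝ) < β / (2 * (n + 1)) by positivity),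
    hL.tendsto.eventually (lt_mem_nhds (half_lt_self hβ))] with j h1 h2
  by_contra! hlt
  rw [(hL.tower j).measureReal_towerSet (measurePreserving_prodCongr hT)] at h2
  have h3 : 0 < h j := by
    rcases Nat.eq_zero_or_pos (h j) with h4 | h4
    · rw [h4] at h2; simp at h2; linarith
    · exact h4
  have h4 : (h j : ℝ) ≤ n + 1 := by exact_mod_cast hlt.le.trans (Nat.le_succ n)
  have h5 : (h j : ℝ) * (μ.prod μ).real (B j) ≤ (n + 1) * (β / (2 * (n + 1))) := by
    gcongr; exact h1 h3
  rw [show ((n : ℝ) + 1) * (β / (2 * (n + 1))) = β / 2 by field_simp] at h5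
  linarith

/-- The set of periodic points. -/
def periodicSet (T : X ≃ᵐ X) : Set X := {x | ∃ m, 0 < m ∧ T^[m] x = x}

lemma measurableSet_iterate_eq_self (T : X ≃ᵐ X) (m : ℕ) : MeasurableSet {x | T^[m] x = x} :=
  measurableSet_eq_fun (T.measurable.iterate m) measurable_id

lemma measurableSet_periodicSet (T : X ≃ᵐ X) : MeasurableSet (periodicSet T) := by
  have : periodicSet T = ⋃ m ∈ Set.Ioi 0, {x | T^[m] x = x} := by
    ext x; simp [periodicSet]
  rw [this]
  exact MeasurableSet.biUnion (Set.to_countable _) fun m _ => measurableSet_iterate_eq_self T m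

lemma preimage_periodicSet {Y : Type*} [MeasurableSpace Y] (T : Y ≃ᵐ Y) :
    T ⁻¹' periodicSet T = periodicSet T := by
  ext x
  refine exists_congr fun m => and_congr_right fun _ => ?_
  rw [← Function.iterate_succ_apply, Function.iterate_succ_apply', T.injective.eq_iff]

/-- A pair of periodic points is periodic for `T × T`. Most such pairs have a period at most some
fixed `n`, and towers of height `2 * n` contain none of these. -/
lemma LocalTowers.eventually_inter_periodic_le [NullSingletonClass μ]
    (hT : MeasurePreserving T μ μ) (hL : LocalTowers (T.prodCongr T) (μ.prod μ) B h β)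
    (hβ : 0 < β) {ε : ℝ} (hε : 0 < ε) : ∀ᶠ j in atTop,
      (μ.prod μ).real (towerSet (T.prodCongr T) (B j) (h j) ∩
        (periodicSet T ×ˢ periodicSet T)) ≤ ε := by
  let S := T.prodCongr T
  let E : ℕ → Set (X × X) := fun n => ⋃ m ∈ Finset.Icc 1 n, {z | S^[m] z = z}
  have hEm : ∀ n, MeasurableSet (E n) := fun n =>
    Finset.measurableSet_biUnion _ fun m _ => measurableSet_iterate_eq_self S m
  have hmono : Monotone E := fun n n' hn =>
    Set.biUnion_subset_biUnion_left fun m hm =>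
      Finset.mem_Icc.2 ⟨(Finset.mem_Icc.1 hm).1, (Finset.mem_Icc.1 hm).2.trans hn⟩
  have hpp : periodicSet T ×ˢ periodicSet T ⊆ ⋃ n, E n := by
    rintro ⟨x, y⟩ ⟨⟨m, hm, hx⟩, ⟨l, hl, hy⟩⟩
    refine Set.mem_iUnion.2 ⟨m * l, ?_⟩
    simp only [E, Set.mem_iUnion]
    refine ⟨m * l, Finset.mem_Icc.2 ⟨Nat.mul_pos hm hl, le_rfl⟩, ?_⟩
    have h1 : T^[m * l] x = x := by
      rw [Function.iterate_mul]; exact Function.iterate_fixed hx l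
    have h2 : T^[m * l] y = y := by
      rw [mul_comm, Function.iterate_mul]; exact Function.iterate_fixed hy m
    change S^[m * l] (x, y) = (x, y)
    rw [iterate_prodCongr]
    exact Prod.ext h1 h2
  have htend := tendsto_measure_iUnion_atTop (μ := μ.prod μ) hmono
  have htend' : Tendsto (fun n => (μ.prod μ).real (E n)) atTop (𝓝 ((μ.prod μ).real (⋃ n, E n))) :=
    (ENNReal.tendsto_toReal (measure_ne_top _ _)).comp htend
  obtain ⟨n, hn⟩ := (htend'.eventually
    (lt_mem_nhds (show (μ.prod μ).real (⋃ n, E n) - ε < _ from sub_lt_self _ hε))).exists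
  filter_upwards [hL.eventually_le_height hT hβ (2 * n)] with j hj
  have hsub : towerSet S (B j) (h j) ∩ (periodicSet T ×ˢ periodicSet T) ⊆ (⋃ n, E n) \ E n := by
    rintro z ⟨hzU, hz⟩
    refine ⟨hpp hz, fun hzE => ?_⟩
    simp only [E, Set.mem_iUnion, Finset.mem_Icc] at hzE
    obtain ⟨m, ⟨hm1, hm2⟩, hz⟩ := hzE
    exact (hL.tower j).iterate_ne_self hj hzU hm1 hm2 hz
  refine (measureReal_mono hsub (measure_ne_top _ _)).trans ?_
  rw [measureReal_sdiff (Set.subset_iUnion _ _) (hEm n)]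
  linarith

/-- Unless it is small, the tower asymptotically avoids the periodic points in both coordinates. -/
lemma LocalTowers.eventually_diff_aperiodic_le [NullSingletonClass μ]
    (hT : MeasurePreserving T μ μ) (hL : LocalTowers (T.prodCongr T) (μ.prod μ) B h β)
    (hβ : 0 < β) (hβt : μ.real (periodicSet T) * (1 - μ.real (periodicSet T)) < β)
    {ε : ℝ} (hε : 0 < ε) : ∀ᶠ j in atTop,
      (μ.prod μ).real (towerSet (T.prodCongr T) (B j) (h j) \
        ((periodicSet T)ᶜ ×ˢ (periodicSet T)ᶜ)) ≤ ε := by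
  have hS := measurePreserving_prodCongr hT
  set p := periodicSet T with hp
  set t := μ.real p with ht
  have hpm : MeasurableSet p := measurableSet_periodicSet T
  have ht0 : 0 ≤ t := measureReal_nonneg
  have ht1 : t ≤ 1 := measureReal_le_one
  have htt : 0 ≤ t * (1 - t) := mul_nonneg ht0 (by linarith)
  have hpc : μ.real pᶜ = 1 - t := by rw [measureReal_compl hpm, probReal_univ]
  obtain ⟨e, he0, he1, he2⟩ : ∃ e : ℝ, 0 < e ∧ 2 * e ≤ ε ∧ 4 * e < β - t * (1 - t) :=
    ⟨min (ε / 2) ((β - t * (1 - t)) / 5), by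
      refine lt_min (by positivity) (by linarith), by
      linarith [min_le_left (ε / 2) ((β - t * (1 - t)) / 5)], by
      linarith [min_le_right (ε / 2) ((β - t * (1 - t)) / 5)]⟩
  filter_upwards [hL.eventually_inter_periodic_le hT hβ he0,
    hL.resolves _ (measurable_fst hpm) e he0, hL.resolves _ (measurable_snd hpm) e he0,
    hL.tendsto.eventually (lt_mem_nhds (sub_lt_self β he0))] with j hpp r1 r2 hU
  have d1 := (hL.tower j).dichotomy hS (measurable_fst hpm) (by
    change Prod.fst ⁻¹' (T ⁻¹' p) = _; rw [hp, preimage_periodicSet]) r1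
  have d2 := (hL.tower j).dichotomy hS (measurable_snd hpm) (by
    change Prod.snd ⁻¹' (T ⁻¹' p) = _; rw [hp, preimage_periodicSet]) r2
  set U := towerSet (T.prodCongr T) (B j) (h j) with hUdef
  have cover : ∀ {s a b c : Set (X × X)}, s ⊆ a ∪ b ∪ c → (μ.prod μ).real s ≤
      (μ.prod μ).real a + (μ.prod μ).real b + (μ.prod μ).real c := fun hs =>
    (measureReal_mono hs (measure_ne_top _ _)).trans ((measureReal_union_le _ _).trans
      (add_le_add (measureReal_union_le _ _) le_rfl))
  -- By the dichotomy the tower is almost contained in one of four products. The two mixed ones have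
  -- measure `t * (1 - t) < β`, which is too small, and in `p ×ˢ p` the tower is negligible.
  rcases d1 with d1 | d1 <;> rcases d2 with d2 | d2
  · have := cover (s := U \ (pᶜ ×ˢ pᶜ)) (a := U ∩ Prod.fst ⁻¹' p) (b := U ∩ Prod.snd ⁻¹' p)
      (c := ∅) (by
        rintro ⟨x, y⟩ ⟨h1, h2⟩
        by_cases hx : x ∈ p <;> by_cases hy : y ∈ p <;> simp_all)
    simp only [measureReal_empty] at this
    linarith
  · have := cover (s := U) (a := U ∩ Prod.fst ⁻¹' p) (b := U \ Prod.snd ⁻¹' p)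
      (c := pᶜ ×ˢ p) (by
        rintro ⟨x, y⟩ h1
        by_cases hx : x ∈ p <;> by_cases hy : y ∈ p <;> simp_all)
    rw [measureReal_prod_prod, hpc] at this
    linarith [mul_comm t (1 - t)]
  · have := cover (s := U) (a := U \ Prod.fst ⁻¹' p) (b := U ∩ Prod.snd ⁻¹' p)
      (c := p ×ˢ pᶜ) (by
        rintro ⟨x, y⟩ h1
        by_cases hx : x ∈ p <;> by_cases hy : y ∈ p <;> simp_all)
    rw [measureReal_prod_prod, hpc] at this
    linarith
  · have := cover (s := U) (a := U \ Prod.fst ⁻¹' p) (b := U \ Prod.snd ⁻¹' p)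
      (c := U ∩ (p ×ˢ p)) (by
        rintro ⟨x, y⟩ h1
        by_cases hx : x ∈ p <;> by_cases hy : y ∈ p <;> simp_all)
    linarith

end Periodic

/-! ### The shift couplings and the bound `1/4`. -/

section Shifts

variable {X : Type*} [MeasurableSpace X] {μ : Measure X} [IsProbabilityMeasure μ] {T : X ≃ᵐ X}

/-- The map `id × T ^ m`, which commutes with `T × T`. -/
def shiftSnd (T : X ≃ᵐ X) (m : ℕ) (z : X × X) : X × X := (z.1, T^[m] z.2)

lemma measurePreserving_shiftSnd (hT : MeasurePreserving T μ μ) (m : ℕ) :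
    MeasurePreserving (shiftSnd T m) (μ.prod μ) (μ.prod μ) :=
  (MeasurePreserving.id μ).prod (hT.iterate m)

lemma shiftSnd_shiftSnd (m n : ℕ) (z : X × X) :
    shiftSnd T m (shiftSnd T n z) = shiftSnd T (m + n) z := by
  simp [shiftSnd, Function.iterate_add_apply]

lemma shiftSnd_prodCongr (m : ℕ) (z : X × X) :
    shiftSnd T m (T.prodCongr T z) = T.prodCongr T (shiftSnd T m z) := by
  refine Prod.ext rfl ?_
  change T^[m] (T z.2) = T (T^[m] z.2)
  rw [← Function.iterate_succ_apply, Function.iterate_succ_apply']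

/-- The distribution of `(z, (id × T ^ m) z)`. -/
noncomputable def shiftCoupling (μ : Measure X) (T : X ≃ᵐ X) (m : ℕ) :
    Measure ((X × X) × (X × X)) :=
  (μ.prod μ).map fun z => (z, shiftSnd T m z)

lemma measurable_graph_shiftSnd (hT : MeasurePreserving T μ μ) (m : ℕ) :
    Measurable fun z => (z, shiftSnd T m z) :=
  measurable_id.prodMk (measurePreserving_shiftSnd hT m).measurable

lemma isProbabilityMeasure_shiftCoupling (hT : MeasurePreserving T μ μ) (m : ℕ) :
    IsProbabilityMeasure (shiftCoupling μ T m) :=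
  Measure.isProbabilityMeasure_map (measurable_graph_shiftSnd hT m).aemeasurable

lemma shiftCoupling_map_fst (hT : MeasurePreserving T μ μ) (m : ℕ) :
    (shiftCoupling μ T m).map Prod.fst = μ.prod μ := by
  rw [shiftCoupling, Measure.map_map measurable_fst (measurable_graph_shiftSnd hT m)]
  exact Measure.map_id

lemma shiftCoupling_map_snd (hT : MeasurePreserving T μ μ) (m : ℕ) :
    (shiftCoupling μ T m).map Prod.snd = μ.prod μ := by
  rw [shiftCoupling, Measure.map_map measurable_snd (measurable_graph_shiftSnd hT m)]
  exact (measurePreserving_shiftSnd hT m).map_eq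

lemma measurePreserving_shiftCoupling (hT : MeasurePreserving T μ μ) (m : ℕ) :
    MeasurePreserving (Prod.map (T.prodCongr T) (T.prodCongr T)) (shiftCoupling μ T m)
      (shiftCoupling μ T m) := by
  have hS := measurePreserving_prodCongr hT
  refine ⟨hS.measurable.prodMap hS.measurable, ?_⟩
  rw [shiftCoupling, Measure.map_map (hS.measurable.prodMap hS.measurable)
    (measurable_graph_shiftSnd hT m)]
  conv_rhs => rw [← hS.map_eq, Measure.map_map (measurable_graph_shiftSnd hT m) hS.measurable]
  congr 1
  funext z
  exact Prod.ext rfl (shiftSnd_prodCongr m z).symm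

/-- Among `N` shifts of a tower, two return to nearby floors with a probability bounded below. -/
lemma exists_shiftCoupling_mass (hT : MeasurePreserving T μ μ) {B : Set (X × X)} {h q Q N : ℕ}
    (ht : IsTower (T.prodCongr T) B h) (hq : h ≤ Q * (q + 1)) (hN : 0 < N) {c : ℕ → ℕ}
    (hc : StrictMono c) (hU : (Q : ℝ) / N < (μ.prod μ).real (towerSet (T.prodCongr T) B h)) : ∃ n n', n < n' ∧ n' < N ∧
      ((μ.prod μ).real (towerSet (T.prodCongr T) B h) - Q / N) / N ^ 2 ≤
        (shiftCoupling μ T (c n' - c n)).real (nearFloors (T.prodCongr T) B h q) := by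
  classical
  set S := T.prodCongr T with hSdef
  set ν := μ.prod μ with hν
  set U := towerSet S B h with hUdef
  let D := nearFloors S B h q
  have hD : MeasurableSet D := ht.measurableSet_nearFloors q
  let R : ℕ → X × X → X × X := fun n => shiftSnd T (c n)
  have hR : ∀ n, MeasurePreserving (R n) ν ν := fun n => measurePreserving_shiftSnd hT _
  let J : Finset (ℕ × ℕ) := (Finset.range N ×ˢ Finset.range N).filter fun p => p.1 < p.2
  let g : ℕ × ℕ → Set (X × X) := fun p => {z | (R p.1 z, R p.2 z) ∈ D}
  have hg : ∀ p, MeasurableSet (g p) := fun p =>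
    ((hR p.1).measurable.prodMk (hR p.2).measurable) hD
  let G : Set (X × X) := ⋃ p ∈ J, g p
  have hG : MeasurableSet G := Finset.measurableSet_biUnion _ fun p _ => hg p
  -- The tower is cut into at most `Q` blocks of `q + 1` consecutive floors. Two points of one block
  -- are on floors at distance at most `q`.
  let P : ℕ → Set (X × X) := fun s =>
    ⋃ k ∈ (Finset.range h).filter (fun k => k / (q + 1) = s), floor S B k
  have hP : ∀ s, MeasurableSet (P s) := fun s => Finset.measurableSet_biUnion _ fun k hk =>
    ht.meas k (Finset.mem_range.1 (Finset.mem_filter.1 hk).1)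
  have memP : ∀ {s z}, z ∈ P s ↔ ∃ k < h, k / (q + 1) = s ∧ z ∈ floor S B k := by
    intro s z
    simp only [P, Set.mem_iUnion, Finset.mem_filter, Finset.mem_range, exists_prop, and_assoc]
  have hN' : (0 : ℝ) < N := by exact_mod_cast hN
  -- Outside `G` no point is sent to the same block by two different shifts, so the preimages of a
  -- block are disjoint. Summing over blocks and shifts bounds `N * ν.real U` by `N * ν.real G + Q`.
  have off : ∀ s, ∑ n ∈ Finset.range N, ν.real (R n ⁻¹' P s \ G) ≤ 1 := by
    intro s
    rw [← measureReal_biUnion_finset]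
    · exact measureReal_le_one
    · have hlt : ∀ n n', n < n' → n' < N → Disjoint (R n ⁻¹' P s \ G) (R n' ⁻¹' P s \ G) := by
        intro n n' hnn hn'
        refine Set.disjoint_left.2 fun z hz hz' => hz.2 ?_
        obtain ⟨k, hk, hks, hzk⟩ := memP.1 hz.1
        obtain ⟨l, hl, hls, hzl⟩ := memP.1 hz'.1
        refine Set.mem_biUnion (x := (n, n')) ?_ ⟨k, hk, l, hl, ?_, ?_, hzk, hzl⟩
        · simp [J, hnn, hn', hnn.trans hn']
        · exact le_add_of_div_succ_eq (hks.trans hls.symm)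
        · exact le_add_of_div_succ_eq (hls.trans hks.symm)
      intro n hn n' hn' hne
      rcases lt_or_gt_of_ne hne with h1 | h1
      · exact hlt n n' h1 (by simpa using hn')
      · exact (hlt n' n h1 (by simpa using hn)).symm
    · exact fun n _ => ((hR n).measurable (hP s)).diff hG
  have cover : ∀ n, ν.real U ≤ ν.real G + ∑ s ∈ Finset.range Q, ν.real (R n ⁻¹' P s \ G) := by
    intro n
    rw [← (hR n).measureReal_preimage ht.measurableSet_towerSet.nullMeasurableSet]
    refine (measureReal_mono (s₂ := G ∪ ⋃ s ∈ Finset.range Q, (R n ⁻¹' P s \ G)) ?_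
      (measure_ne_top _ _)).trans ((measureReal_union_le _ _).trans
        (add_le_add le_rfl (measureReal_biUnion_finset_le _ _)))
    intro z hz
    by_cases hzG : z ∈ G
    · exact Or.inl hzG
    obtain ⟨k, hk, hzk⟩ := mem_towerSet.1 hz
    refine Or.inr (Set.mem_biUnion (x := k / (q + 1)) ?_ ⟨memP.2 ⟨k, hk, rfl, hzk⟩, hzG⟩)
    simp only [Finset.coe_range, Set.mem_Iio]
    exact (Nat.div_lt_iff_lt_mul (Nat.succ_pos q)).2 (hk.trans_le hq)
  have h1 : N * ν.real U ≤ N * ν.real G + Q := by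
    calc N * ν.real U = ∑ _n ∈ Finset.range N, ν.real U := by simp
      _ ≤ ∑ n ∈ Finset.range N,
          (ν.real G + ∑ s ∈ Finset.range Q, ν.real (R n ⁻¹' P s \ G)) :=
            Finset.sum_le_sum fun n _ => cover n
      _ = N * ν.real G + ∑ s ∈ Finset.range Q, ∑ n ∈ Finset.range N, ν.real (R n ⁻¹' P s \ G) := by
          rw [Finset.sum_add_distrib, Finset.sum_comm]; simp
      _ ≤ N * ν.real G + ∑ _s ∈ Finset.range Q, (1 : ℝ) := by
          gcongr with s; exact off s
      _ = _ := by simp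
  have h2 : ν.real U - Q / N ≤ ν.real G := by
    rw [sub_le_iff_le_add, ← mul_le_mul_iff_right₀ hN', mul_add, mul_div_cancel₀ _ hN'.ne']
    exact h1
  have lawg : ∀ p : ℕ × ℕ, p.1 < p.2 →
      ν.real (g p) = (shiftCoupling μ T (c p.2 - c p.1)).real D := by
    intro p hp
    have hm := measurable_graph_shiftSnd hT (c p.2 - c p.1)
    rw [shiftCoupling, map_measureReal_apply hm hD,
      ← (hR p.1).measureReal_preimage (hm hD).nullMeasurableSet]
    congr 1
    ext z
    simp only [Set.mem_preimage, g, R, Set.mem_ofPred_eq]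
    rw [shiftSnd_shiftSnd, Nat.sub_add_cancel (hc hp).le]
  by_contra! hcon
  have hJ : ∀ p ∈ J, p.1 < p.2 ∧ p.2 < N := fun p hp => by
    simp only [J, Finset.mem_filter, Finset.mem_product, Finset.mem_range] at hp
    exact ⟨hp.2, hp.1.2⟩
  have hUle : ν.real G ≤ ∑ p ∈ J, ν.real (g p) := measureReal_biUnion_finset_le _ _
  have hcard : (J.card : ℝ) ≤ (N : ℝ) ^ 2 := by
    have : J.card ≤ N ^ 2 := (Finset.card_filter_le _ _).trans (by simp [sq])
    exact_mod_cast this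
  set a := (ν.real U - Q / N) / (N : ℝ) ^ 2 with ha
  have ha0 : 0 < a := div_pos (by linarith) (by positivity)
  have haN : (N : ℝ) ^ 2 * a = ν.real U - Q / N := by rw [ha]; field_simp
  have hlt : ∑ p ∈ J, ν.real (g p) < ν.real U - Q / N := by
    rcases J.eq_empty_or_nonempty with hJe | hJe
    · rw [hJe, Finset.sum_empty]; linarith
    · calc ∑ p ∈ J, ν.real (g p) < ∑ _p ∈ J, a := Finset.sum_lt_sum_of_nonempty hJe fun p hp => by
            rw [lawg p (hJ p hp).1]
            exact hcon _ _ (hJ p hp).1 (hJ p hp).2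
        _ = J.card * a := by simp
        _ ≤ (N : ℝ) ^ 2 * a := by gcongr
        _ = _ := haN
  linarith

/-- Some power of `T × T` is close to `id × T ^ m` on a part of the space whose measure is nearly
that of the towers. -/
theorem LocalTowers.exists_agree (hT : MeasurePreserving T μ μ) {B : ℕ → Set (X × X)}
    {h : ℕ → ℕ} {β : ℝ} (hL : LocalTowers (T.prodCongr T) (μ.prod μ) B h β) (hβ : 0 < β)
    {E : Set X}
    (hE : ∀ ε : ℝ, 0 < ε → ∀ᶠ j in atTop,
      (μ.prod μ).real (towerSet (T.prodCongr T) (B j) (h j) \ E ×ˢ E) ≤ ε)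
    {c : ℕ → ℕ} (hc : StrictMono c) {ε : ℝ} (hε : 0 < ε) :
    ∃ N : ℕ, ∀ {ι : Type} [Fintype ι] (A : ι → Set X), (∀ i, MeasurableSet (A i)) →
      ∃ n n' a b, n < n' ∧ n' < N ∧
        β - ε ≤ μ.real {x | x ∈ E ∧ ∀ i, T^[a] x ∈ A i ↔ T^[b] x ∈ A i} *
          μ.real {x | x ∈ E ∧ ∀ i, T^[c n' - c n + a] x ∈ A i ↔ T^[b] x ∈ A i} := by
  obtain ⟨Q, hQ⟩ := exists_nat_gt (4 / ε)
  have hQ0 : (0 : ℝ) < Q := lt_trans (by positivity) hQ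
  -- `Q` makes the loss of `h / Q` floors at most `ε / 4`, and `N` makes the mass in the pigeonhole
  -- argument at least `β / 4 / N ^ 2`. Neither depends on the sets `A`, so these may be chosen
  -- after `N`.
  obtain ⟨N, hN⟩ := exists_nat_gt (4 * Q / β)
  have hN0 : (0 : ℝ) < N := lt_trans (by positivity) hN
  refine ⟨N, fun {ι} _ A hA => ?_⟩
  have hS := measurePreserving_prodCongr hT
  set δ : ℝ := β / 4 / N ^ 2 with hδ
  have hδ0 : 0 < δ := by positivity
  obtain ⟨e, he0, he⟩ : ∃ e : ℝ, 0 < e ∧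
      4 * Fintype.card (ι ⊕ ι) * e * (1 + 1 / δ) ≤ ε / 4 := by
    set u : ℝ := 4 * Fintype.card (ι ⊕ ι) * (1 + 1 / δ) with hu
    have hu0 : 0 ≤ u := by positivity
    refine ⟨ε / 4 / (u + 1), by positivity, ?_⟩
    rw [show 4 * (Fintype.card (ι ⊕ ι) : ℝ) * (ε / 4 / (u + 1)) * (1 + 1 / δ) =
      ε / 4 * (u / (u + 1)) by rw [hu]; ring]
    refine mul_le_of_le_one_right (by positivity) ?_
    rw [div_le_one (by positivity)]
    linarith
  have ev1 : ∀ᶠ j in atTop, ∀ i, Resolves (μ.prod μ) (T.prodCongr T) (B j) (h j)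
      (Prod.fst ⁻¹' A i) e :=
    eventually_all.2 fun i => hL.resolves _ (measurable_fst (hA i)) e he0
  have hA2 : ∀ m i, MeasurableSet (Prod.snd ⁻¹' (T^[m] ⁻¹' A i) : Set (X × X)) := fun m i =>
    measurable_snd (T.measurable.iterate m (hA i))
  have ev2 : ∀ᶠ j in atTop, ∀ m ∈ Finset.range (c N + 1), ∀ i,
      Resolves (μ.prod μ) (T.prodCongr T) (B j) (h j) (Prod.snd ⁻¹' (T^[m] ⁻¹' A i)) e :=
    (Finset.eventually_all _).2 fun m _ => eventually_all.2 fun i =>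
      hL.resolves _ (hA2 m i) e he0
  obtain ⟨j, r1, r2, hU1, hU2, hUE⟩ := (ev1.and (ev2.and
    ((hL.tendsto.eventually (lt_mem_nhds (half_lt_self hβ))).and
    ((hL.tendsto.eventually (lt_mem_nhds (sub_lt_self β (show 0 < ε / 4 by positivity)))).and
      (hE (ε / 4) (by positivity)))))).exists
  set U := towerSet (T.prodCongr T) (B j) (h j) with hUdef
  have hQN : (Q : ℝ) / N < β / 4 := by
    rw [div_lt_iff₀ hβ] at hN
    rw [div_lt_iff₀ hN0]
    linarith
  obtain ⟨n, n', hnn, hnN, hmass⟩ := exists_shiftCoupling_mass hT (hL.tower j)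
    (q := h j / Q) (Q := Q) (N := N)
    ((Nat.lt_mul_div_succ (h j) (by exact_mod_cast hQ0)).le)
    (by exact_mod_cast hN0) hc (by linarith)
  set m := c n' - c n with hm
  have hmN : m ∈ Finset.range (c N + 1) := by
    rw [Finset.mem_range]
    have := hc hnN
    omega
  have := isProbabilityMeasure_shiftCoupling hT m
  have hmm := measurable_graph_shiftSnd hT m
  -- The coupling identifies first coordinates, and identifies `T^m` of the second coordinate of one
  -- point with the second coordinate of the other. The relations on the two coordinates are
  -- separate, whence the product of two measures.
  obtain ⟨a, b, hab⟩ := exists_iterates_agree (ι := ι ⊕ ι) hS (shiftCoupling_map_fst hT m)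
    (shiftCoupling_map_snd hT m) (measurePreserving_shiftCoupling hT m) (hL.tower j)
    (q := h j / Q) (e := e)
    (P := Sum.elim (fun i => Prod.fst ⁻¹' A i) fun i => Prod.snd ⁻¹' (T^[m] ⁻¹' A i))
    (P' := Sum.elim (fun i => Prod.fst ⁻¹' A i) fun i => Prod.snd ⁻¹' (T^[0] ⁻¹' A i))
    (by rintro (i | i); exacts [measurable_fst (hA i), hA2 m i])
    (by rintro (i | i); exacts [measurable_fst (hA i), hA2 0 i])
    (by rintro (i | i); exacts [r1 i, r2 m hmN i])
    (by rintro (i | i); exacts [r1 i, r2 0 (Finset.mem_range.2 (Nat.succ_pos _)) i])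
    (by
      rintro (i | i)
      · exact (ae_map_iff hmm.aemeasurable
          (MeasurableSet.iff (measurable_fst (measurable_fst (hA i)))
            (measurable_snd (measurable_fst (hA i))))).2 (Eventually.of_forall fun z => Iff.rfl)
      · exact (ae_map_iff hmm.aemeasurable
          (MeasurableSet.iff (measurable_fst (hA2 m i)) (measurable_snd (hA2 0 i)))).2
            (Eventually.of_forall fun z => Iff.rfl))
    hδ0 (le_trans (by rw [hδ]; gcongr; linarith) hmass)
  refine ⟨n, n', a, b, hnn, hnN, ?_⟩
  set G1 := {x | x ∈ E ∧ ∀ i, T^[a] x ∈ A i ↔ T^[b] x ∈ A i}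
  set G2 := {x | x ∈ E ∧ ∀ i, T^[m + a] x ∈ A i ↔ T^[b] x ∈ A i}
  have hsub : {z ∈ U | ∀ i : ι ⊕ ι,
      (T.prodCongr T)^[a] z ∈ Sum.elim (fun i => Prod.fst ⁻¹' A i)
        (fun i => Prod.snd ⁻¹' (T^[m] ⁻¹' A i)) i ↔
      (T.prodCongr T)^[b] z ∈ Sum.elim (fun i => Prod.fst ⁻¹' A i)
        (fun i => Prod.snd ⁻¹' (T^[0] ⁻¹' A i)) i} ⊆ (U \ E ×ˢ E) ∪ G1 ×ˢ G2 := by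
    rintro z ⟨hzU, hz⟩
    by_cases hzE : z ∈ E ×ˢ E
    · right
      refine ⟨⟨hzE.1, fun i => ?_⟩, hzE.2, fun i => ?_⟩
      · have := hz (Sum.inl i)
        rwa [iterate_prodCongr, iterate_prodCongr] at this
      · have := hz (Sum.inr i)
        rw [iterate_prodCongr, iterate_prodCongr] at this
        rw [Function.iterate_add_apply]
        exact this
    · exact Or.inl ⟨hzU, hzE⟩
  have h1 := (measureReal_mono hsub (measure_ne_top (μ.prod μ) _)).trans (measureReal_union_le _ _)
  rw [measureReal_prod_prod] at h1
  have h2 : (μ.prod μ).real U - ε / 4 ≤ ((h j : ℝ) - (h j / Q : ℕ)) * (μ.prod μ).real (B j) := by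
    have h3 : (μ.prod μ).real U = h j * (μ.prod μ).real (B j) :=
      (hL.tower j).measureReal_towerSet hS
    have h4 : ((h j / Q : ℕ) : ℝ) ≤ h j / Q := Nat.cast_div_le
    have h5 : (μ.prod μ).real U ≤ 1 := measureReal_le_one
    have h6 : 0 ≤ (μ.prod μ).real (B j) := measureReal_nonneg
    have h7 : ((h j / Q : ℕ) : ℝ) * (μ.prod μ).real (B j) ≤ ε / 4 := by
      calc ((h j / Q : ℕ) : ℝ) * (μ.prod μ).real (B j)
          ≤ h j / Q * (μ.prod μ).real (B j) := by gcongr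
        _ = (μ.prod μ).real U / Q := by rw [h3]; ring
        _ ≤ 1 / Q := by gcongr
        _ ≤ ε / 4 := by
          rw [div_lt_iff₀ hε] at hQ
          rw [div_le_iff₀ hQ0]
          linarith
    rw [sub_mul, ← h3]
    linarith
  linarith

/-- On the aperiodic part, finitely many sets almost separate `x` from `T ^ m x`. -/
lemma exists_measureReal_agree_iterate_le [StandardBorelSpace X] (T : X ≃ᵐ X)
    (μ : Measure X) [IsProbabilityMeasure μ] (M : ℕ) {ε : ℝ} (hε : 0 < ε) :
    ∃ (I : ℕ) (A : Fin I → Set X), (∀ i, MeasurableSet (A i)) ∧ ∀ m, 0 < m → m < M →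
      μ.real {x | x ∈ (periodicSet T)ᶜ ∧ ∀ i, x ∈ A i ↔ T^[m] x ∈ A i} ≤ ε := by
  obtain ⟨C, hC, hsep⟩ := exists_separating_seq X
  have hpm := (measurableSet_periodicSet T).compl
  have hgm : ∀ m, Measurable fun x : X => (x, T^[m] x) := fun m =>
    measurable_id.prodMk (T.measurable.iterate m)
  have ev : ∀ᶠ I : ℕ in atTop, ∀ m ∈ Finset.range M, 0 < m →
      μ.real {x | x ∈ (periodicSet T)ᶜ ∧ ∀ i : Fin I, x ∈ C i ↔ T^[m] x ∈ C i} ≤ ε := by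
    rw [Finset.eventually_all]
    intro m _
    rcases Nat.eq_zero_or_pos m with rfl | hm
    · exact Eventually.of_forall fun _ h => absurd h (lt_irrefl _)
    have h0 : ((μ.restrict (periodicSet T)ᶜ).map fun x => (x, T^[m] x)) (Set.diagonal X) = 0 := by
      rw [Measure.map_apply (hgm m) measurableSet_diagonal,
        Measure.restrict_apply (hgm m measurableSet_diagonal)]
      convert! measure_empty (μ := μ)
      ext x
      simp only [Set.mem_inter_iff, Set.mem_preimage, Set.mem_diagonal_iff, Set.mem_compl_iff,
        Set.mem_empty_iff_false, iff_false, not_and, not_not]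
      exact fun hx => ⟨m, hm, hx.symm⟩
    filter_upwards [(tendsto_measureReal_forall_mem_iff hC hsep _ h0).eventually
      (ge_mem_nhds hε)] with I hI _
    refine le_trans (le_of_eq ?_) hI
    have hm2 : MeasurableSet {p : X × X | ∀ i : Fin I, p.1 ∈ C i ↔ p.2 ∈ C i} :=
      measurableSet_forall_mem_iff (Z := X × X) (ι := Fin I)
        (P := fun i => Prod.fst ⁻¹' C i) (P' := fun i => Prod.snd ⁻¹' C i)
        (fun i => measurable_fst (hC i)) (fun i => measurable_snd (hC i))
    rw [map_measureReal_apply (hgm m) hm2, measureReal_restrict_apply' hpm]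
    congr 1
    ext x
    exact and_comm
  obtain ⟨I, hI⟩ := ev.exists
  exact ⟨I, fun i => C i, fun i => hC i, fun m hm hmM => hI m (Finset.mem_range.2 hmM) hm⟩

/-- On the intersection `T^a x` agrees with `T^m (T^a x)`; `T^a` preserves both the measure and the
aperiodic part. -/
lemma measureReal_agree_add_agree_le [StandardBorelSpace X] (hT : MeasurePreserving T μ μ)
    {ι : Type*} [Countable ι] {A : ι → Set X} (hA : ∀ i, MeasurableSet (A i)) (m a b : ℕ) :
    μ.real ({x | x ∈ (periodicSet T)ᶜ ∧ ∀ i, T^[a] x ∈ A i ↔ T^[b] x ∈ A i} ∩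
      {x | x ∈ (periodicSet T)ᶜ ∧ ∀ i, T^[m + a] x ∈ A i ↔ T^[b] x ∈ A i}) ≤
      μ.real {x | x ∈ (periodicSet T)ᶜ ∧ ∀ i, x ∈ A i ↔ T^[m] x ∈ A i} := by
  have hpm := (measurableSet_periodicSet T).compl
  have hinv : ∀ a, T^[a] ⁻¹' (periodicSet T)ᶜ = (periodicSet T)ᶜ := by
    intro a
    induction a with
    | zero => rfl
    | succ a ih =>
      rw [Function.iterate_succ, Set.preimage_comp, ih, Set.preimage_compl, preimage_periodicSet]
  have hm2 : MeasurableSet {x | x ∈ (periodicSet T)ᶜ ∧ ∀ i, x ∈ A i ↔ T^[m] x ∈ A i} :=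
    hpm.inter (measurableSet_forall_mem_iff hA fun i => T.measurable.iterate m (hA i))
  rw [← (hT.iterate a).measureReal_preimage hm2.nullMeasurableSet]
  refine measureReal_mono ?_ (measure_ne_top _ _)
  rintro x ⟨⟨hx, h1⟩, -, h2⟩
  refine ⟨show x ∈ T^[a] ⁻¹' (periodicSet T)ᶜ by rwa [hinv], fun i => ?_⟩
  rw [← Function.iterate_add_apply]
  exact (h1 i).trans (h2 i).symm

theorem HasLocalTowers.le_quarter [StandardBorelSpace X] [NullSingletonClass μ]
    (hT : MeasurePreserving T μ μ) {b : ℝ≥0∞}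
    (hb : HasLocalTowers (T.prodCongr T) (μ.prod μ) b) : b ≤ 1 / 4 := by
  obtain ⟨hbt, B, h, hL⟩ := hb.exists_localTowers
  set β := b.toReal with hβ
  suffices hs : β ≤ 1 / 4 by
    rw [← ENNReal.ofReal_toReal hbt]
    refine (ENNReal.ofReal_le_ofReal hs).trans (le_of_eq ?_)
    rw [ENNReal.ofReal_div_of_pos (by norm_num)]
    norm_num
  by_contra! hlt
  set t := μ.real (periodicSet T)
  have hβ0 : 0 < β := by linarith
  -- Since `t * (1 - t) ≤ 1 / 4 < β`, the towers concentrate on pairs of aperiodic points.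
  have hE := fun ε hε => hL.eventually_diff_aperiodic_le hT hβ0 (ε := ε)
    (by nlinarith [sq_nonneg (t - 1 / 2)]) hε
  obtain ⟨ε, hε0, hε1, hε2⟩ : ∃ ε : ℝ, 0 < ε ∧ ε ≤ 1 ∧ 2 * ε < β - 1 / 4 :=
    ⟨min 1 ((β - 1 / 4) / 3), lt_min one_pos (by linarith), min_le_left _ _, by
      linarith [min_le_right 1 ((β - 1 / 4) / 3)]⟩
  obtain ⟨N, hN⟩ := hL.exists_agree hT hβ0 hE strictMono_id hε0
  obtain ⟨I, A, hA, hAm⟩ := exists_measureReal_agree_iterate_le T μ N hε0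
  obtain ⟨n, n', a, b, hnn, hnN, hle⟩ := hN A hA
  simp only [id] at hle
  have hint := (measureReal_agree_add_agree_le hT hA (n' - n) a b).trans
    (hAm (n' - n) (by omega) (by omega))
  have hG2 : MeasurableSet
      {x | x ∈ (periodicSet T)ᶜ ∧ ∀ i, T^[n' - n + a] x ∈ A i ↔ T^[b] x ∈ A i} :=
    (measurableSet_periodicSet T).compl.inter (measurableSet_forall_mem_iff
      (fun i => T.measurable.iterate _ (hA i)) fun i => T.measurable.iterate _ (hA i))
  have hun := measureReal_union_add_inter (μ := μ)
    (s := {x | x ∈ (periodicSet T)ᶜ ∧ ∀ i, T^[a] x ∈ A i ↔ T^[b] x ∈ A i}) hG2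
  set g1 := μ.real {x | x ∈ (periodicSet T)ᶜ ∧ ∀ i, T^[a] x ∈ A i ↔ T^[b] x ∈ A i}
  set g2 := μ.real {x | x ∈ (periodicSet T)ᶜ ∧ ∀ i, T^[n' - n + a] x ∈ A i ↔ T^[b] x ∈ A i}
  have hone : ∀ s, μ.real s ≤ 1 := fun s => measureReal_le_one
  have hsum : g1 + g2 ≤ 1 + ε := by
    rw [← hun]; exact add_le_add (hone _) hint
  have g1n : 0 ≤ g1 := measureReal_nonneg
  have g2n : 0 ≤ g2 := measureReal_nonneg
  nlinarith [sq_nonneg (g1 - g2), mul_self_le_mul_self (add_nonneg g1n g2n) hsum]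

theorem localRank_prodCongr_le [StandardBorelSpace X] [NullSingletonClass μ]
    (hT : MeasurePreserving T μ μ) : localRank (T.prodCongr T) (μ.prod μ) ≤ 1 / 4 :=
  sSup_le fun _ hb => hb.le_quarter hT

end Shifts

/-! ### Koopman operators and the mean ergodic theorem. -/

section Koopman

variable {Z : Type*} [MeasurableSpace Z] {ν : Measure Z} {S : Z ≃ᵐ Z}

lemma norm_koopman_pow (hS : MeasurePreserving S ν ν) (n : ℕ) (f : Lp ℂ 2 ν) :
    ‖(koopman S hS ^ n) f‖ = ‖f‖ := by
  induction n with
  | zero => rfl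
  | succ n ih =>
    rw [pow_succ', mul_apply_eq_comp, ← ih]
    exact (Lp.compMeasurePreservingₗᵢ ℂ S hS).norm_map _

variable [IsProbabilityMeasure ν]

/-- The indicator function of a measurable set as an element of `L²`. -/
noncomputable def ind (ν : Measure Z) [IsProbabilityMeasure ν] {A : Set Z} (hA : MeasurableSet A) :
    Lp ℂ 2 ν := indicatorConstLp 2 hA (measure_ne_top ν A) 1

lemma inner_ind_ind {A B : Set Z} (hA : MeasurableSet A) (hB : MeasurableSet B) :
    inner ℂ (ind ν hA) (ind ν hB) = (ν.real (A ∩ B) : ℂ) := by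
  rw [ind, ind, L2.inner_indicatorConstLp_indicatorConstLp]
  simp

lemma ind_univ : ind ν MeasurableSet.univ = Lp.const 2 ν (1 : ℂ) := by
  rw [ind, indicatorConstLp_univ]

lemma norm_ind_le {A : Set Z} (hA : MeasurableSet A) : ‖ind ν hA‖ ≤ 1 := by
  rw [ind, norm_indicatorConstLp (by norm_num) (by norm_num), norm_one, one_mul]
  exact Real.rpow_le_one measureReal_nonneg measureReal_le_one (by positivity)

lemma norm_const_one : ‖Lp.const 2 ν (1 : ℂ)‖ = 1 := by
  rw [Lp.norm_const' _ _ _ (by norm_num) (by norm_num)]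
  simp

lemma theta_apply (f : Lp ℂ 2 ν) :
    theta ν f = inner ℂ (Lp.const 2 ν (1 : ℂ)) f • Lp.const 2 ν (1 : ℂ) :=
  Submodule.starProjection_unit_singleton ℂ norm_const_one f

lemma theta_ind {A : Set Z} (hA : MeasurableSet A) :
    theta ν (ind ν hA) = (ν.real A : ℂ) • Lp.const 2 ν (1 : ℂ) := by
  rw [theta_apply, ← ind_univ, inner_ind_ind, Set.univ_inter]

lemma koopman_ind (hS : MeasurePreserving S ν ν) {A : Set Z} (hA : MeasurableSet A) :
    koopman S hS (ind ν hA) = ind ν (S.measurable hA) :=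
  Lp.indicatorConstLp_compMeasurePreserving hA _ _ hS

lemma koopman_pow_ind (hS : MeasurePreserving S ν ν) {A : Set Z} (hA : MeasurableSet A) (n : ℕ) :
    (koopman S hS ^ n) (ind ν hA) = ind ν (S.measurable.iterate n hA) := by
  induction n with
  | zero => rfl
  | succ n ih =>
    rw [pow_succ', mul_apply_eq_comp, ih, koopman_ind]
    rfl

lemma koopman_pow_const (hS : MeasurePreserving S ν ν) (n : ℕ) :
    (koopman S hS ^ n) (Lp.const 2 ν (1 : ℂ)) = Lp.const 2 ν (1 : ℂ) := by
  rw [← ind_univ, koopman_pow_ind]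
  rfl

/-- This is von Neumann's theorem; ergodicity says that the fixed vectors are the constants. -/
lemma tendsto_birkhoffAverage_koopman (hS : Ergodic S ν) (f : Lp ℂ 2 ν) :
    Tendsto (fun n => birkhoffAverage ℂ (koopman S hS.toMeasurePreserving) id n f) atTop
      (𝓝 (theta ν f)) := by
  have hS' := hS.toMeasurePreserving
  have h1 := (koopman S hS').tendsto_birkhoffAverage_orthogonalProjection
    (LinearIsometry.norm_toContinuousLinearMap_le _) f
  have h2 : (koopman S hS').eqLocus (1 : Lp ℂ 2 ν →L[ℂ] Lp ℂ 2 ν) =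
      Submodule.span ℂ {Lp.const 2 ν (1 : ℂ)} := by
    refine le_antisymm (fun g hg => ?_) ?_
    · have hg' : koopman S hS' g = g := hg
      have hc : (g ∘ S : Z → ℂ) =ᵐ[ν] g := by
        have := Lp.coeFn_compMeasurePreserving g hS'
        refine this.symm.trans ?_
        conv_rhs => rw [← hg']
        rfl
      obtain ⟨c, hc⟩ := hS.ae_eq_const_of_ae_eq_comp_ae (Lp.aestronglyMeasurable g) hc
      refine Submodule.mem_span_singleton.2 ⟨c, ?_⟩
      refine Lp.ext ?_
      refine (Lp.coeFn_smul _ _).trans ?_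
      filter_upwards [Lp.coeFn_const 2 ν (1 : ℂ), hc] with x h3 h4
      simp [h4]
    · rw [Submodule.span_singleton_le_iff_mem]
      have := koopman_pow_const hS' 1
      rwa [pow_one] at this
  have h3 : ∀ (K : Submodule ℂ (Lp ℂ 2 ν)) [K.HasOrthogonalProjection],
      K = Submodule.span ℂ {Lp.const 2 ν (1 : ℂ)} →
        (K.orthogonalProjectionOnto f : Lp ℂ 2 ν) = theta ν f := by
    rintro K _ rfl
    rfl
  rwa [h3 _ h2] at h1

/-- Mean ergodic theorem for sets, uniformly in the set `G`. -/
lemma eventually_sum_measureReal_inter_le (hS : Ergodic S ν) {W : Set Z} (hW : MeasurableSet W)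
    {ε : ℝ} (hε : 0 < ε) : ∀ᶠ J : ℕ in atTop, ∀ a : ℕ, ∀ G, MeasurableSet G →
      |∑ s ∈ Finset.range J, ν.real (G ∩ S^[s + a] ⁻¹' W) - J * (ν.real G * ν.real W)| ≤ J * ε := by
  have hS' := hS.toMeasurePreserving
  have h1 := (tendsto_birkhoffAverage_koopman hS (ind ν hW)).eventually
    (Metric.ball_mem_nhds _ hε)
  filter_upwards [h1, eventually_gt_atTop 0] with J hJ hJ0 a G hG
  have hJ0' : (0 : ℝ) < J := by exact_mod_cast hJ0
  set V := koopman S hS' with hV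
  set x := birkhoffAverage ℂ V id J (ind ν hW) with hx
  have e1 : inner ℂ (ind ν hG) ((V ^ a) (x - theta ν (ind ν hW))) =
      (((∑ s ∈ Finset.range J, ν.real (G ∩ S^[s + a] ⁻¹' W)) / J - ν.real G * ν.real W : ℝ) : ℂ) := by
    rw [map_sub, inner_sub_right, theta_ind, map_smul, koopman_pow_const, inner_smul_right,
      ← ind_univ, inner_ind_ind, Set.inter_univ, hx, birkhoffAverage, birkhoffSum, map_smul,
      map_sum, inner_smul_right, inner_sum]
    have : ∀ s ∈ Finset.range J, inner ℂ (ind ν hG) ((V ^ a) (id (V^[s] (ind ν hW)))) =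
        (ν.real (G ∩ S^[s + a] ⁻¹' W) : ℂ) := by
      intro s _
      have hVs : V^[s] = ⇑(V ^ s) := (hom_coe_pow _ rfl (fun _ _ => rfl) V s).symm
      rw [id, hVs, ← mul_apply_eq_comp, ← pow_add,
        koopman_pow_ind, inner_ind_ind, add_comm]
    rw [Finset.sum_congr rfl this]
    push_cast
    ring
  -- The bound is uniform in `a` and `G` because `V ^ a` is isometric and the indicator of `G` has
  -- norm at most `1`.
  have e2 : ‖inner ℂ (ind ν hG) ((V ^ a) (x - theta ν (ind ν hW)))‖ ≤ ε := by
    refine (norm_inner_le_norm _ _).trans ?_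
    rw [norm_koopman_pow]
    rw [dist_eq_norm] at hJ
    calc _ ≤ 1 * ‖x - theta ν (ind ν hW)‖ := by gcongr; exact norm_ind_le hG
      _ ≤ ε := by rw [one_mul]; exact hJ.le
  rw [e1, Complex.norm_real, Real.norm_eq_abs] at e2
  have e3 : ∑ s ∈ Finset.range J, ν.real (G ∩ S^[s + a] ⁻¹' W) - J * (ν.real G * ν.real W) =
      J * ((∑ s ∈ Finset.range J, ν.real (G ∩ S^[s + a] ⁻¹' W)) / J - ν.real G * ν.real W) := by
    field_simp
  rw [e3, abs_mul, abs_of_pos hJ0']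
  gcongr

end Koopman

/-! ### Weak mixing from ergodicity of `T × T`. -/

section WeakMixing

variable {X : Type*} [MeasurableSpace X] {μ : Measure X} [IsProbabilityMeasure μ] {T : X ≃ᵐ X}

lemma ergodic_of_ergodic_prodCongr (hT : MeasurePreserving T μ μ)
    (hS : Ergodic (T.prodCongr T) (μ.prod μ)) : Ergodic T μ :=
  (measurePreserving_fst (μ := μ) (ν := μ)).ergodic_of_ergodic_semiconj hS hT.measurable
    fun _ => rfl

/-- If `T × T` is ergodic, then `T` is weakly mixing: finitely many pairs of sets become almost
independent at arbitrarily large times. -/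
lemma exists_ge_almost_independent (hT : MeasurePreserving T μ μ)
    (hS : Ergodic (T.prodCongr T) (μ.prod μ)) {ι : Type*} [Fintype ι] {A A' : ι → Set X}
    (hA : ∀ i, MeasurableSet (A i)) (hA' : ∀ i, MeasurableSet (A' i)) {ε : ℝ} (hε : 0 < ε)
    (K : ℕ) : ∃ n, K ≤ n ∧
      ∀ i, |μ.real (A i ∩ T^[n] ⁻¹' A' i) - μ.real (A i) * μ.real (A' i)| ≤ ε := by
  have hTe := ergodic_of_ergodic_prodCongr hT hS
  set η : ℝ := ε ^ 2 / (6 * (Fintype.card ι + 1)) with hη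
  have hη0 : 0 < η := by positivity
  have ev1 := eventually_all.2 fun i => eventually_sum_measureReal_inter_le hTe (hA' i) hη0
  have ev2 := eventually_all.2 fun i =>
    eventually_sum_measureReal_inter_le hS ((hA' i).prod (hA' i)) hη0
  obtain ⟨J, h1, h2, hJ⟩ := (ev1.and (ev2.and (eventually_gt_atTop (2 * K)))).exists
  by_contra! hcon
  let x : ι → ℕ → ℝ := fun i s => μ.real (A i ∩ T^[s] ⁻¹' A' i)
  let c : ι → ℝ := fun i => μ.real (A i) * μ.real (A' i)
  have hc0 : ∀ i, 0 ≤ c i := fun i => mul_nonneg measureReal_nonneg measureReal_nonneg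
  have hc1 : ∀ i, c i ≤ 1 := fun i =>
    mul_le_one₀ measureReal_le_one measureReal_nonneg measureReal_le_one
  have b1 : ∀ i, |∑ s ∈ Finset.range J, x i s - J * c i| ≤ J * η := fun i => h1 i 0 (A i) (hA i)
  -- Squares of correlations are correlations of product sets under `T × T`. Control of the first
  -- two moments bounds the variance, so large deviations cannot occur at all times from `K` to `J`.
  have b2 : ∀ i, |∑ s ∈ Finset.range J, x i s ^ 2 - J * c i ^ 2| ≤ J * η := by
    intro i
    have := h2 i 0 (A i ×ˢ A i) ((hA i).prod (hA i))
    have e1 : ∀ s, (μ.prod μ).real (A i ×ˢ A i ∩ (T.prodCongr T)^[s + 0] ⁻¹' (A' i ×ˢ A' i)) =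
        x i s ^ 2 := by
      intro s
      rw [sq, ← measureReal_prod_prod]
      congr 1
      ext z
      simp only [add_zero, Set.mem_inter_iff, Set.mem_preimage, Set.mem_prod, iterate_prodCongr]
      tauto
    have e2 : (μ.prod μ).real (A i ×ˢ A i) * (μ.prod μ).real (A' i ×ˢ A' i) = c i ^ 2 := by
      rw [measureReal_prod_prod, measureReal_prod_prod]; ring
    simp only [e1, e2] at this
    exact this
  have b3 : ∀ i, ∑ s ∈ Finset.range J, (x i s - c i) ^ 2 ≤ 3 * (J * η) := by
    intro i
    have e : ∑ s ∈ Finset.range J, (x i s - c i) ^ 2 =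
        (∑ s ∈ Finset.range J, x i s ^ 2 - J * c i ^ 2) -
          2 * c i * (∑ s ∈ Finset.range J, x i s - J * c i) := by
      simp only [sub_sq, Finset.sum_add_distrib, Finset.sum_sub_distrib, Finset.sum_const,
        Finset.card_range, nsmul_eq_mul, ← Finset.sum_mul, ← Finset.mul_sum]
      ring
    rw [e]
    have h3 := (abs_le.1 (b2 i)).2
    have h4 := (abs_le.1 (b1 i)).1
    have h5 : 0 ≤ J * η := by positivity
    nlinarith [hc0 i, hc1 i, mul_le_mul_of_nonneg_left h4 (hc0 i),
      mul_le_mul_of_nonneg_right (hc1 i) h5]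
  have b4 : ∀ s ∈ Finset.Ico K J, ε ^ 2 ≤ ∑ i, (x i s - c i) ^ 2 := by
    intro s hs
    obtain ⟨i, hi⟩ := hcon s (Finset.mem_Ico.1 hs).1
    calc ε ^ 2 ≤ (x i s - c i) ^ 2 := by
          rw [← sq_abs (x i s - c i)]
          exact pow_le_pow_left₀ hε.le hi.le 2
      _ ≤ _ := Finset.single_le_sum (f := fun i => (x i s - c i) ^ 2)
          (fun i _ => sq_nonneg _) (Finset.mem_univ i)
  have b5 : ((J : ℝ) - K) * ε ^ 2 ≤ Fintype.card ι * (3 * (J * η)) := by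
    calc ((J : ℝ) - K) * ε ^ 2 = ∑ _s ∈ Finset.Ico K J, ε ^ 2 := by
          rw [Finset.sum_const, Nat.card_Ico, nsmul_eq_mul, Nat.cast_sub (by omega)]
      _ ≤ ∑ s ∈ Finset.Ico K J, ∑ i, (x i s - c i) ^ 2 := Finset.sum_le_sum b4
      _ ≤ ∑ s ∈ Finset.range J, ∑ i, (x i s - c i) ^ 2 :=
          Finset.sum_le_sum_of_subset_of_nonneg
            (fun s hs => Finset.mem_range.2 (Finset.mem_Ico.1 hs).2)
            fun s _ _ => Finset.sum_nonneg fun i _ => sq_nonneg _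
      _ = ∑ i, ∑ s ∈ Finset.range J, (x i s - c i) ^ 2 := Finset.sum_comm
      _ ≤ ∑ _i : ι, 3 * (J * η) := Finset.sum_le_sum fun i _ => b3 i
      _ = _ := by simp
  have hJ' : 2 * (K : ℝ) < J := by exact_mod_cast hJ
  have hJ0 : (0 : ℝ) < J := lt_of_le_of_lt (by positivity) hJ'
  have b6 : (Fintype.card ι : ℝ) * (3 * (J * η)) ≤ J / 2 * ε ^ 2 := by
    rw [hη, show (Fintype.card ι : ℝ) * (3 * (J * (ε ^ 2 / (6 * (Fintype.card ι + 1))))) =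
      J / 2 * ε ^ 2 * (Fintype.card ι / (Fintype.card ι + 1)) by field_simp; ring]
    refine mul_le_of_le_one_right (by positivity) ?_
    rw [div_le_one (by positivity)]
    linarith
  have : (J : ℝ) - K ≤ J / 2 := le_of_mul_le_mul_right (b5.trans b6) (by positivity)
  linarith

/-- A sequence along all of whose differences finitely many sets are almost independent. -/
lemma exists_strictMono_almost_independent (hT : MeasurePreserving T μ μ)
    (hS : Ergodic (T.prodCongr T) (μ.prod μ)) {ι : Type*} [Fintype ι] {A : ι → Set X}
    (hA : ∀ i, MeasurableSet (A i)) {ε : ℝ} (hε : 0 < ε) :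
    ∃ c : ℕ → ℕ, StrictMono c ∧ ∀ n n', n < n' → ∀ i j,
      |μ.real (A i ∩ T^[c n' - c n] ⁻¹' A j) - μ.real (A i) * μ.real (A j)| ≤ ε := by
  obtain ⟨c, -, hc⟩ := exists_seq_of_forall_finset_exists (fun _ : ℕ => True)
    (fun x y => x < y ∧ ∀ i j,
      |μ.real (A i ∩ T^[y - x] ⁻¹' A j) - μ.real (A i) * μ.real (A j)| ≤ ε) (by
    intro s _
    -- The correlation at time `y - x` is that of `T^(-x) A i` with `A j` at time `y`, so a single
    -- `y` serves all earlier `x`.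
    obtain ⟨y, hy, hys⟩ := exists_ge_almost_independent hT hS (ι := s × ι × ι)
      (A := fun p => T^[(p.1 : ℕ)] ⁻¹' A p.2.1) (A' := fun p => A p.2.2)
      (fun p => T.measurable.iterate _ (hA _)) (fun p => hA _) hε (s.sup id + 1)
    refine ⟨y, trivial, fun x hx => ?_⟩
    have hxy : x < y := (Finset.le_sup (f := id) hx).trans_lt hy
    refine ⟨hxy, fun i j => ?_⟩
    have h1 := hys (⟨x, hx⟩, i, j)
    simp only at h1
    rw [(hT.iterate x).measureReal_preimage (hA i).nullMeasurableSet] at h1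
    convert! h1 using 3
    rw [← (hT.iterate x).measureReal_preimage
      ((hA i).inter (T.measurable.iterate _ (hA j))).nullMeasurableSet, Set.preimage_inter,
      ← Set.preimage_comp, ← Function.iterate_add, Nat.sub_add_cancel hxy.le])
  exact ⟨c, fun m n hmn => (hc m n hmn).1, fun n n' h => (hc n n' h).2⟩

end WeakMixing

/-! ### The case of equality. -/

section HalfMixing

/-- Stability in the inequality of the means: `(p₀ - q)² = (p₀ + q)² - 4 p₀ q ≤ (1 + ε')² - 1 + 8 ε'
≤ 11 ε' = ε²`, and likewise for `p - q`. -/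
lemma near_half_of_quarter_le_mul {p p₀ q q₀ ε ε' : ℝ} (hε : 0 < ε) (hε1 : ε ≤ 1)
    (hε' : ε' = ε ^ 2 / 11) (hp : 0 ≤ p) (hq : 0 ≤ q) (hpp : p ≤ p₀) (hqq : q ≤ q₀)
    (hpq : 1 / 4 - 2 * ε' ≤ p * q) (h1 : p₀ + q ≤ 1 + ε') :
    |p - 1 / 2| ≤ ε ∧ p₀ - p ≤ 2 * ε ∧ 1 - (p₀ + q₀) ≤ 8 * ε' := by
  have e0 : 0 < ε' := by rw [hε']; positivity
  have e1 : ε' ≤ ε / 11 := by rw [hε']; nlinarith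
  have a1 : |p₀ - q| ≤ ε := by
    refine abs_le_of_sq_le_sq ?_ hε.le
    nlinarith [mul_self_le_mul_self (by linarith : 0 ≤ p₀ + q) h1,
      mul_le_mul_of_nonneg_right hpp hq]
  have a2 : |p - q| ≤ ε := by
    refine abs_le_of_sq_le_sq ?_ hε.le
    nlinarith [mul_self_le_mul_self (by linarith : 0 ≤ p + q) (by linarith : p + q ≤ 1 + ε')]
  have a3 : 1 - 8 * ε' ≤ p + q := by
    by_contra! h
    nlinarith [sq_nonneg (p - q), mul_self_le_mul_self (by linarith : 0 ≤ p + q) h.le]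
  rw [abs_le] at a1 a2 ⊢
  refine ⟨⟨?_, ?_⟩, ?_, ?_⟩ <;> linarith

variable {X : Type*} [MeasurableSpace X] {μ : Measure X} [IsProbabilityMeasure μ] {T : X ≃ᵐ X}

/-- If a set `G₀` is nearly invariant and a long Birkhoff average of `W` is nearly constant, then
`G₀` and `T ^ (-a) W` are nearly independent. -/
lemma near_independent_of_near_invariant (hT : MeasurePreserving T μ μ) {G G₀ W : Set X}
    (hG : MeasurableSet G) (hG₀ : MeasurableSet G₀) (hW : MeasurableSet W) {J a : ℕ} (hJ : 0 < J)
    (hsub : ∀ s < J, G ⊆ T^[s] ⁻¹' G₀) {ε ε' : ℝ} (hp : |μ.real G - 1 / 2| ≤ ε)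
    (hp' : μ.real G₀ - μ.real G ≤ 2 * ε) (hε : ε' ≤ ε)
    (hav : |∑ s ∈ Finset.range J, μ.real (G ∩ T^[s + a] ⁻¹' W) - J * (μ.real G * μ.real W)| ≤
      J * ε') : |μ.real (G₀ ∩ T^[a] ⁻¹' W) - μ.real W / 2| ≤ 4 * ε := by
  have hJ' : (0 : ℝ) < J := by exact_mod_cast hJ
  set v := μ.real (G₀ ∩ T^[a] ⁻¹' W) with hv
  have hWa : ∀ n, MeasurableSet (T^[n] ⁻¹' W) := fun n => T.measurable.iterate n hW
  -- By invariance of `μ` the number `v` may be computed at every time `s < J`, where `T^(-s) G₀`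
  -- exceeds the fixed set `G` by at most `2 * ε`. Averaging over `s` then brings in `hav`.
  have step : ∀ s ∈ Finset.range J,
      μ.real (G ∩ T^[s + a] ⁻¹' W) ≤ v ∧ v ≤ μ.real (G ∩ T^[s + a] ⁻¹' W) + 2 * ε := by
    intro s hs
    have hGs := hsub s (Finset.mem_range.1 hs)
    have e1 : v = μ.real (T^[s] ⁻¹' G₀ ∩ T^[s + a] ⁻¹' W) := by
      rw [hv, ← (hT.iterate s).measureReal_preimage (hG₀.inter (hWa a)).nullMeasurableSet,
        Set.preimage_inter, ← Set.preimage_comp, ← Function.iterate_add, add_comm a s]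
    have e2 : μ.real (T^[s] ⁻¹' G₀ \ G) ≤ 2 * ε := by
      rw [measureReal_sdiff hGs hG,
        (hT.iterate s).measureReal_preimage hG₀.nullMeasurableSet]
      exact hp'
    refine ⟨?_, ?_⟩
    · rw [e1]
      exact measureReal_mono (Set.inter_subset_inter_left _ hGs) (measure_ne_top _ _)
    · rw [e1]
      refine (measureReal_mono (s₂ := (G ∩ T^[s + a] ⁻¹' W) ∪ (T^[s] ⁻¹' G₀ \ G)) ?_
        (measure_ne_top _ _)).trans ((measureReal_union_le _ _).trans (by linarith))
      rintro x ⟨h1, h2⟩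
      by_cases hx : x ∈ G
      · exact Or.inl ⟨hx, h2⟩
      · exact Or.inr ⟨h1, hx⟩
  have s1 : ∑ s ∈ Finset.range J, μ.real (G ∩ T^[s + a] ⁻¹' W) ≤ J * v := by
    simpa using Finset.sum_le_sum fun s hs => (step s hs).1
  have s2 : J * v ≤ ∑ s ∈ Finset.range J, μ.real (G ∩ T^[s + a] ⁻¹' W) + J * (2 * ε) := by
    have := Finset.sum_le_sum fun s hs => (step s hs).2
    simpa [Finset.sum_add_distrib] using this
  have hw0 : 0 ≤ μ.real W := measureReal_nonneg
  have hw1 : μ.real W ≤ 1 := measureReal_le_one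
  have t1 : |μ.real G * μ.real W - μ.real W / 2| ≤ ε := by
    rw [show μ.real G * μ.real W - μ.real W / 2 = (μ.real G - 1 / 2) * μ.real W by ring, abs_mul,
      abs_of_nonneg hw0]
    exact (mul_le_of_le_one_right (abs_nonneg _) hw1).trans hp
  rw [abs_le] at hav t1 ⊢
  have u1 : J * (μ.real G * μ.real W - ε') ≤ J * v := by rw [mul_sub]; linarith
  have u2 : J * v ≤ J * (μ.real G * μ.real W + ε' + 2 * ε) := by rw [mul_add, mul_add]; linarith
  have u1' := le_of_mul_le_mul_left u1 hJ'
  have u2' := le_of_mul_le_mul_left u2 hJ'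
  constructor <;> linarith

/-- If two complementary events switch between `T ^ b ≈ T ^ a` and `T ^ b ≈ T ^ (m + a)`, then the
correlations at times `a`, `b` are averages of those at times `0` and `m`. -/
lemma near_average_of_near_complementary (hT : MeasurePreserving T μ μ) {G₀ G₀' A A' : Set X}
    (hA : MeasurableSet A) (hA' : MeasurableSet A') (hG₀ : MeasurableSet G₀) {m a b : ℕ}
    (h1 : ∀ x ∈ G₀, T^[a] x ∈ A' ↔ T^[b] x ∈ A')
    (h2 : ∀ x ∈ G₀', T^[m + a] x ∈ A' ↔ T^[b] x ∈ A') {ε ε' : ℝ}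
    (hc : μ.real (G₀ ∪ G₀')ᶜ ≤ 9 * ε') (he : 10 * ε' ≤ ε)
    (hi1 : |μ.real (G₀ ∩ T^[a] ⁻¹' (A ∩ A')) - μ.real (A ∩ A') / 2| ≤ 4 * ε)
    (hi2 : |μ.real (G₀ ∩ T^[a] ⁻¹' (A ∩ T^[m] ⁻¹' A')) - μ.real (A ∩ T^[m] ⁻¹' A') / 2| ≤ 4 * ε)
    (hm : |μ.real (A ∩ T^[m] ⁻¹' A') - μ.real A * μ.real A'| ≤ ε') :
    |μ.real (T^[a] ⁻¹' A ∩ T^[b] ⁻¹' A') - (μ.real (A ∩ A') / 2 + μ.real A * μ.real A' / 2)| ≤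
      9 * ε := by
  set R := T^[a] ⁻¹' A ∩ T^[b] ⁻¹' A' with hR
  set V := A ∩ T^[m] ⁻¹' A' with hV
  have e1 : R ∩ G₀ = G₀ ∩ T^[a] ⁻¹' (A ∩ A') := by
    ext x
    constructor
    · rintro ⟨⟨h3, h4⟩, h5⟩; exact ⟨h5, h3, (h1 x h5).2 h4⟩
    · rintro ⟨h5, h3, h4⟩; exact ⟨⟨h3, (h1 x h5).1 h4⟩, h5⟩
  have e2 : ∀ x ∈ G₀', x ∈ R ↔ x ∈ T^[a] ⁻¹' V := by
    intro x hx
    have := h2 x hx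
    rw [Function.iterate_add_apply] at this
    exact and_congr_right fun _ => this.symm
  have e3 := measureReal_inter_add_sdiff (μ := μ) (s := R) hG₀
  have e4 := measureReal_inter_add_sdiff (μ := μ) (s := T^[a] ⁻¹' V) hG₀
  rw [(hT.iterate a).measureReal_preimage
    (hA.inter (T.measurable.iterate m hA')).nullMeasurableSet, Set.inter_comm] at e4
  rw [e1] at e3
  -- Almost all of the complement of `G₀` lies in `G₀'`, where `R` coincides with `T^(-a) V`. Hence
  -- independence is needed for `G₀` only: outside it one subtracts from `μ.real V`.
  have cmp : ∀ {P Q : Set X}, (∀ x ∈ G₀', x ∈ P → x ∈ Q) →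
      μ.real (P \ G₀) ≤ μ.real (Q \ G₀) + 9 * ε' := by
    intro P Q hPQ
    refine (measureReal_mono (s₂ := (Q \ G₀) ∪ (G₀ ∪ G₀')ᶜ) ?_ (measure_ne_top _ _)).trans
      ((measureReal_union_le _ _).trans (by linarith))
    rintro x ⟨hx, hxG⟩
    by_cases hx' : x ∈ G₀'
    · exact Or.inl ⟨hPQ x hx' hx, hxG⟩
    · exact Or.inr fun h => h.elim hxG hx'
  have c1 := cmp fun x hx => (e2 x hx).1
  have c2 := cmp fun x hx => (e2 x hx).2
  rw [abs_le] at *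
  constructor <;> linarith

/-- If `T × T` is ergodic of local rank `1 / 4`, then at some time the correlations of finitely
many sets are close to those of a `1 / 2`-mixing. -/
theorem exists_half_mixing_time [StandardBorelSpace X] [NullSingletonClass μ]
    (hT : MeasurePreserving T μ μ) (hS : Ergodic (T.prodCongr T) (μ.prod μ))
    (hr : localRank (T.prodCongr T) (μ.prod μ) = 1 / 4) {K : ℕ} {A : Fin K → Set X}
    (hA : ∀ i, MeasurableSet (A i)) {ε₀ : ℝ} (hε₀ : 0 < ε₀) :
    ∃ n, ∀ i j, |μ.real (A i ∩ T^[n] ⁻¹' A j) -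
      (μ.real (A i ∩ A j) / 2 + μ.real (A i) * μ.real (A j) / 2)| ≤ ε₀ := by
  have hTe := ergodic_of_ergodic_prodCongr hT hS
  obtain ⟨ε, hε, hε1, hεε⟩ : ∃ ε : ℝ, 0 < ε ∧ ε ≤ 1 ∧ 9 * ε ≤ ε₀ :=
    ⟨min 1 (ε₀ / 9), lt_min one_pos (by positivity), min_le_left _ _, by
      linarith [min_le_right 1 (ε₀ / 9)]⟩
  set ε' : ℝ := ε ^ 2 / 11 with hε'
  have e0 : 0 < ε' := by positivity
  have e1 : ε' ≤ ε / 11 := by rw [hε']; nlinarith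
  -- towers of measure close to `1 / 4`
  obtain ⟨β, hβ, hβ0, B, h, hL⟩ : ∃ β : ℝ, 1 / 4 - ε' < β ∧ 0 < β ∧
      ∃ B h, LocalTowers (T.prodCongr T) (μ.prod μ) B h β := by
    have hpos : 0 < 1 / 4 - ε' := by linarith
    have hlt : ENNReal.ofReal (1 / 4 - ε') < localRank (T.prodCongr T) (μ.prod μ) := by
      rw [hr, ENNReal.ofReal_lt_iff_lt_toReal hpos.le (by simp)]
      simp only [one_div, ENNReal.toReal_inv, ENNReal.toReal_ofNat]
      linarith
    obtain ⟨b, hb, hlb⟩ := lt_sSup_iff.1 hlt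
    obtain ⟨hbt, B, h, hL⟩ := HasLocalTowers.exists_localTowers hb
    have hβ := (ENNReal.ofReal_lt_iff_lt_toReal hpos.le hbt).1 hlb
    exact ⟨b.toReal, hβ, hpos.trans hβ, B, h, hL⟩
  -- `T` is aperiodic
  set E := (periodicSet T)ᶜ with hEdef
  have hpm := measurableSet_periodicSet T
  have hEm : MeasurableSet E := hpm.compl
  have ht01 : μ.real (periodicSet T) = 0 ∨ μ.real (periodicSet T) = 1 := by
    rcases hTe.toPreErgodic.prob_eq_zero_or_one hpm (preimage_periodicSet T) with h1 | h1 <;>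
      simp [Measure.real, h1]
  have hEU : ∀ ε : ℝ, 0 < ε → ∀ᶠ j in atTop,
      (μ.prod μ).real (towerSet (T.prodCongr T) (B j) (h j) \ E ×ˢ E) ≤ ε := fun ε hε =>
    hL.eventually_diff_aperiodic_le hT hβ0 (by rcases ht01 with h1 | h1 <;> rw [h1] <;> linarith) hε
  have hE1 : μ.real E = 1 := by
    rw [hEdef, measureReal_compl hpm, probReal_univ]
    rcases ht01 with h1 | h1
    · rw [h1, sub_zero]
    · exfalso
      obtain ⟨j, h2, h3⟩ := ((hEU (β / 2) (half_pos hβ0)).and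
        (hL.tendsto.eventually (lt_mem_nhds (half_lt_self hβ0)))).exists
      have hE0 : μ.real E = 0 := by rw [hEdef, measureReal_compl hpm, probReal_univ, h1, sub_self]
      have h4 : (μ.prod μ).real (towerSet (T.prodCongr T) (B j) (h j)) ≤
          (μ.prod μ).real (towerSet (T.prodCongr T) (B j) (h j) \ E ×ˢ E) +
            (μ.prod μ).real (E ×ˢ E) := by
        refine (measureReal_mono ?_ (measure_ne_top _ _)).trans (measureReal_union_le _ _)
        intro z hz
        by_cases hzE : z ∈ E ×ˢ E
        exacts [Or.inr hzE, Or.inl ⟨hz, hzE⟩]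
      rw [measureReal_prod_prod, hE0, zero_mul, add_zero] at h4
      linarith
  -- the parameters
  obtain ⟨c, hc, hmix⟩ := exists_strictMono_almost_independent hT hS hA e0
  obtain ⟨N, hN⟩ := hL.exists_agree hT hβ0 hEU hc e0
  obtain ⟨I, D, hD, hDm⟩ := exists_measureReal_agree_iterate_le T μ (c N + 1) e0
  -- The sets `A` carry the correlations; the sets `D` make the two agreement events almost
  -- disjoint.
  let F : Fin K ⊕ Fin I → Set X := Sum.elim A D
  have hF : ∀ i, MeasurableSet (F i) := by rintro (i | i); exacts [hA i, hD i]
  have evJ : ∀ᶠ J : ℕ in atTop, ∀ m ∈ Finset.range (c N + 1), ∀ i j, ∀ a : ℕ, ∀ G,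
      MeasurableSet G → |∑ s ∈ Finset.range J, μ.real (G ∩ T^[s + a] ⁻¹' (A i ∩ T^[m] ⁻¹' A j)) -
        J * (μ.real G * μ.real (A i ∩ T^[m] ⁻¹' A j))| ≤ J * ε' :=
    (Finset.eventually_all _).2 fun m _ => eventually_all.2 fun i => eventually_all.2 fun j =>
      eventually_sum_measureReal_inter_le hTe ((hA i).inter (T.measurable.iterate m (hA j))) e0
  obtain ⟨J, hJ, hJ0⟩ := (evJ.and (eventually_gt_atTop 0)).exists
  -- Agreement is required for the preimages of the sets `F` under all `T^s`, `s < J`. Thus `G` lies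
  -- in every `T^(-s) G₀`, and since their measures are close, `G₀` is almost invariant.
  obtain ⟨n, n', a, b, hnn, hnN, hle⟩ := hN
    (fun p : (Fin K ⊕ Fin I) × Fin J => T^[(p.2 : ℕ)] ⁻¹' F p.1)
    (fun p => T.measurable.iterate _ (hF p.1))
  set m := c n' - c n with hm
  have hm0 : 0 < m := Nat.sub_pos_of_lt (hc hnn)
  have hmN : m < c N + 1 := by
    have := hc hnN
    omega
  set G := {x | x ∈ E ∧ ∀ p : (Fin K ⊕ Fin I) × Fin J,
    T^[a] x ∈ T^[(p.2 : ℕ)] ⁻¹' F p.1 ↔ T^[b] x ∈ T^[(p.2 : ℕ)] ⁻¹' F p.1} with hGdef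
  set G' := {x | x ∈ E ∧ ∀ p : (Fin K ⊕ Fin I) × Fin J,
    T^[m + a] x ∈ T^[(p.2 : ℕ)] ⁻¹' F p.1 ↔ T^[b] x ∈ T^[(p.2 : ℕ)] ⁻¹' F p.1} with hGdef'
  set G₀ := {x | x ∈ E ∧ ∀ i, T^[a] x ∈ F i ↔ T^[b] x ∈ F i} with hGdef₀
  set G₀' := {x | x ∈ E ∧ ∀ i, T^[m + a] x ∈ F i ↔ T^[b] x ∈ F i} with hGdef₀'
  have hTn : ∀ n {s}, MeasurableSet s → MeasurableSet (T^[n] ⁻¹' s) := fun n _ hs =>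
    T.measurable.iterate n hs
  have hGm : MeasurableSet G := hEm.inter (measurableSet_forall_mem_iff
    (fun p : (Fin K ⊕ Fin I) × Fin J => hTn a (hTn p.2 (hF p.1)))
    fun p => hTn b (hTn p.2 (hF p.1)))
  have hG₀m : MeasurableSet G₀ := hEm.inter (measurableSet_forall_mem_iff
    (fun i => hTn a (hF i)) fun i => hTn b (hF i))
  have hG₀'m : MeasurableSet G₀' := hEm.inter (measurableSet_forall_mem_iff
    (fun i => hTn (m + a) (hF i)) fun i => hTn b (hF i))
  have hEinv : ∀ s, T^[s] ⁻¹' E = E := by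
    intro s
    induction s with
    | zero => rfl
    | succ s ih =>
      rw [Function.iterate_succ, Set.preimage_comp, ih, hEdef, Set.preimage_compl,
        preimage_periodicSet]
  have comm : ∀ k l x, T^[k] (T^[l] x) = T^[l] (T^[k] x) := fun k l x => by
    rw [← Function.iterate_add_apply, ← Function.iterate_add_apply, add_comm]
  have hsub : ∀ s < J, G ⊆ T^[s] ⁻¹' G₀ := by
    rintro s hs x ⟨hx, hx'⟩
    refine ⟨show x ∈ T^[s] ⁻¹' E by rwa [hEinv], fun i => ?_⟩
    rw [comm a s, comm b s]
    exact hx' (i, ⟨s, hs⟩)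
  have hsub' : G' ⊆ G₀' := fun x hx => ⟨hx.1, fun i => hx.2 (i, ⟨0, hJ0⟩)⟩
  have hint : μ.real (G₀ ∩ G₀') ≤ ε' := by
    refine (measureReal_agree_add_agree_le hT hF m a b).trans (le_trans ?_ (hDm m hm0 hmN))
    exact measureReal_mono (fun x hx => ⟨hx.1, fun i => hx.2 (Sum.inr i)⟩) (measure_ne_top _ _)
  have hun := measureReal_union_add_inter (μ := μ) (s := G₀) hG₀'m
  have hq : μ.real G' ≤ μ.real G₀' := measureReal_mono hsub' (measure_ne_top _ _)
  have hunion : μ.real (G₀ ∪ G₀') ≤ 1 := measureReal_le_one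
  obtain ⟨n1, n2, n3⟩ := near_half_of_quarter_le_mul (p := μ.real G) (p₀ := μ.real G₀)
    (q := μ.real G') (q₀ := μ.real G₀') hε hε1 hε' measureReal_nonneg measureReal_nonneg
    (measureReal_mono (hsub 0 hJ0) (measure_ne_top _ _)) hq (by linarith) (by linarith)
  have hcompl : μ.real (G₀ ∪ G₀')ᶜ ≤ 9 * ε' := by
    rw [measureReal_compl (hG₀m.union hG₀'m), probReal_univ]
    linarith
  have avg : ∀ i j, |μ.real (T^[a] ⁻¹' A i ∩ T^[b] ⁻¹' A j) -
      (μ.real (A i ∩ A j) / 2 + μ.real (A i) * μ.real (A j) / 2)| ≤ 9 * ε := by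
    intro i j
    have ind : ∀ l < c N + 1, |μ.real (G₀ ∩ T^[a] ⁻¹' (A i ∩ T^[l] ⁻¹' A j)) -
        μ.real (A i ∩ T^[l] ⁻¹' A j) / 2| ≤ 4 * ε := fun l hl =>
      near_independent_of_near_invariant hT hGm hG₀m ((hA i).inter (hTn l (hA j))) hJ0 hsub n1 n2
        (by linarith) (hJ l (Finset.mem_range.2 hl) i j a G hGm)
    exact near_average_of_near_complementary hT (hA i) (hA j) hG₀m
      (fun x hx => hx.2 (Sum.inl j)) (fun x hx => hx.2 (Sum.inl j)) hcompl (by linarith)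
      (ind 0 (Nat.succ_pos _)) (ind m hmN) (hmix n n' hnn i j)
  -- The limit correlations are symmetric in `A i` and `A j`, so the sign of `b - a` is irrelevant.
  rcases le_total a b with hab | hab
  · refine ⟨b - a, fun i j => ?_⟩
    have e : μ.real (A i ∩ T^[b - a] ⁻¹' A j) = μ.real (T^[a] ⁻¹' A i ∩ T^[b] ⁻¹' A j) := by
      rw [← (hT.iterate a).measureReal_preimage ((hA i).inter (hTn _ (hA j))).nullMeasurableSet,
        Set.preimage_inter, ← Set.preimage_comp, ← Function.iterate_add, Nat.sub_add_cancel hab]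
    rw [e]
    exact (avg i j).trans hεε
  · refine ⟨a - b, fun i j => ?_⟩
    have e : μ.real (A i ∩ T^[a - b] ⁻¹' A j) = μ.real (T^[a] ⁻¹' A j ∩ T^[b] ⁻¹' A i) := by
      rw [← (hT.iterate b).measureReal_preimage ((hA i).inter (hTn _ (hA j))).nullMeasurableSet,
        Set.preimage_inter, ← Set.preimage_comp, ← Function.iterate_add, Nat.sub_add_cancel hab,
        Set.inter_comm]
    rw [e, Set.inter_comm (A i), mul_comm (μ.real (A i))]
    exact (avg j i).trans hεε

end HalfMixing

/-! ### From correlations of sets to weak operator convergence. -/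

section WeakOperatorLimits

/-- The Lipschitz constant is uniform in `p`, so convergence passes to limits of vectors. -/
lemma isClosed_setOf_tendsto_zero {P H : Type*} [NormedAddCommGroup H] (l : Filter P)
    (φ : P → H → ℂ) {C : ℝ} (hφ : ∀ p f f', ‖φ p f - φ p f'‖ ≤ C * ‖f - f'‖) :
    IsClosed {f | Tendsto (fun p => φ p f) l (𝓝 0)} := by
  refine isClosed_of_closure_subset fun f hf => ?_
  rw [Set.mem_ofPred_eq, Metric.tendsto_nhds]
  intro ε hε
  have hC : 0 < |C| + 1 := by positivity
  obtain ⟨f', hf', hd⟩ := Metric.mem_closure_iff.1 hf (ε / 2 / (|C| + 1)) (by positivity)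
  filter_upwards [Metric.tendsto_nhds.1 hf' (ε / 2) (half_pos hε)] with p hp
  rw [dist_zero_right] at hp ⊢
  rw [dist_eq_norm, lt_div_iff₀ hC] at hd
  have h1 := hφ p f f'
  have h2 : C * ‖f - f'‖ ≤ ‖f - f'‖ * (|C| + 1) := by
    rw [mul_comm]
    gcongr
    linarith [le_abs_self C]
  have h3 := norm_sub_norm_le (φ p f) (φ p f')
  linarith

section

variable {P H : Type*} [NormedAddCommGroup H] [InnerProductSpace ℂ H] {l : Filter P}
  {V : P → H →L[ℂ] H} {M : H →L[ℂ] H}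

lemma isClosed_setOf_tendsto_inner_right (hV : ∀ p f, ‖V p f‖ ≤ ‖f‖) (g : H) :
    IsClosed {f | Tendsto (fun p => inner ℂ g (V p f)) l (𝓝 (inner ℂ g (M f)))} := by
  have := isClosed_setOf_tendsto_zero l (fun p f => inner ℂ g (V p f) - inner ℂ g (M f))
    (C := ‖g‖ * (1 + ‖M‖)) (fun p f f' => by
      rw [← inner_sub_right, ← inner_sub_right, ← inner_sub_right]
      refine (norm_inner_le_norm _ _).trans ?_
      rw [mul_assoc]
      gcongr
      rw [sub_sub_sub_comm, ← map_sub, ← map_sub, add_mul, one_mul]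
      exact (norm_sub_le _ _).trans (add_le_add (hV p _) (M.le_opNorm _)))
  simpa only [tendsto_sub_nhds_zero_iff] using this

lemma isClosed_setOf_tendsto_inner_left (hV : ∀ p f, ‖V p f‖ ≤ ‖f‖) (f : H) :
    IsClosed {g | Tendsto (fun p => inner ℂ g (V p f)) l (𝓝 (inner ℂ g (M f)))} := by
  have := isClosed_setOf_tendsto_zero l (fun p g => inner ℂ g (V p f) - inner ℂ g (M f))
    (C := ‖f‖ + ‖M f‖) (fun p g g' => by
      rw [← inner_sub_right, ← inner_sub_right, ← inner_sub_left, mul_comm]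
      refine (norm_inner_le_norm _ _).trans ?_
      gcongr
      exact (norm_sub_le _ _).trans (add_le_add (hV p _) le_rfl))
  simpa only [tendsto_sub_nhds_zero_iff] using this

end

variable {X : Type*} [MeasurableSpace X] {μ : Measure X} [IsProbabilityMeasure μ]

lemma indicatorConstLp_eq_smul_ind {A : Set X} (hA : MeasurableSet A) (hμ : μ A ≠ ⊤) (c : ℂ) :
    indicatorConstLp 2 hA hμ c = c • ind μ hA := by
  refine Lp.ext ?_
  refine indicatorConstLp_coeFn.trans (EventuallyEq.trans ?_ (Lp.coeFn_smul _ _).symm)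
  have h1 : ind μ hA =ᵐ[μ] A.indicator fun _ => (1 : ℂ) := indicatorConstLp_coeFn
  filter_upwards [h1] with x hx
  by_cases hxA : x ∈ A <;> simp [hx, hxA]

/-- In `L²`, weak operator convergence of contractions may be tested on indicator functions. -/
lemma tendsto_inner_of_tendsto_inner_ind {P : Type*} {l : Filter P}
    {V : P → Lp ℂ 2 μ →L[ℂ] Lp ℂ 2 μ} {M : Lp ℂ 2 μ →L[ℂ] Lp ℂ 2 μ}
    (hV : ∀ p f, ‖V p f‖ ≤ ‖f‖)
    (h : ∀ A B (hA : MeasurableSet A) (hB : MeasurableSet B),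
      Tendsto (fun p => inner ℂ (ind μ hA) (V p (ind μ hB))) l
        (𝓝 (inner ℂ (ind μ hA) (M (ind μ hB))))) (f g : Lp ℂ 2 μ) :
    Tendsto (fun p => inner ℂ g (V p f)) l (𝓝 (inner ℂ g (M f))) := by
  have key : ∀ A (hA : MeasurableSet A) (f : Lp ℂ 2 μ),
      Tendsto (fun p => inner ℂ (ind μ hA) (V p f)) l (𝓝 (inner ℂ (ind μ hA) (M f))) := by
    intro A hA f
    refine Lp.induction (by norm_num) (fun f => Tendsto (fun p => inner ℂ (ind μ hA) (V p f)) l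
      (𝓝 (inner ℂ (ind μ hA) (M f)))) (fun c B hB hμB => ?_) (fun f g hf hg _ h1 h2 => ?_)
      (isClosed_setOf_tendsto_inner_right hV _) f
    · rw [Lp.simpleFunc.coe_indicatorConst, indicatorConstLp_eq_smul_ind]
      simp only [map_smul, inner_smul_right]
      exact (h A B hA hB).const_mul c
    · simp only [map_add, inner_add_right]
      exact h1.add h2
  refine Lp.induction (by norm_num) (fun g => Tendsto (fun p => inner ℂ g (V p f)) l
    (𝓝 (inner ℂ g (M f)))) (fun c B hB hμB => ?_) (fun f g hf hg _ h1 h2 => ?_)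
    (isClosed_setOf_tendsto_inner_left hV _) g
  · rw [Lp.simpleFunc.coe_indicatorConst, indicatorConstLp_eq_smul_ind]
    simp only [inner_smul_left]
    exact (key B hB f).const_mul _
  · simp only [inner_add_left]
    exact h1.add h2

/-- A weak operator limit of a net of contractions of a separable space is the limit of a sequence
of operators of the net. -/
lemma exists_seq_tendsto_inner {P H : Type*} [NormedAddCommGroup H] [InnerProductSpace ℂ H]
    [TopologicalSpace.SeparableSpace H] {l : Filter P} [l.NeBot] {V : P → H →L[ℂ] H}
    {M : H →L[ℂ] H} (hV : ∀ p f, ‖V p f‖ ≤ ‖f‖)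
    (h : ∀ f g, Tendsto (fun p => inner ℂ g (V p f)) l (𝓝 (inner ℂ g (M f)))) :
    ∃ p : ℕ → P, ∀ f g, Tendsto (fun i => inner ℂ g (V (p i) f)) atTop (𝓝 (inner ℂ g (M f))) := by
  let d := TopologicalSpace.denseSeq H
  have hd : Dense (Set.range d) := TopologicalSpace.denseRange_denseSeq H
  have ex : ∀ i : ℕ, ∃ p, ∀ k ∈ Finset.range i, ∀ m ∈ Finset.range i,
      dist (inner ℂ (d m) (V p (d k))) (inner ℂ (d m) (M (d k))) < 1 / ((i : ℝ) + 1) := by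
    intro i
    refine Eventually.exists (f := l) ?_
    rw [Finset.eventually_all]
    intro k _
    rw [Finset.eventually_all]
    intro m _
    exact Metric.tendsto_nhds.1 (h _ _) _ (by positivity)
  choose p hp using ex
  refine ⟨p, ?_⟩
  have key : ∀ k m, Tendsto (fun i => inner ℂ (d m) (V (p i) (d k))) atTop
      (𝓝 (inner ℂ (d m) (M (d k)))) := by
    intro k m
    rw [tendsto_iff_dist_tendsto_zero]
    refine squeeze_zero' (Eventually.of_forall fun _ => dist_nonneg) ?_
      tendsto_one_div_add_atTop_nhds_zero_nat
    filter_upwards [eventually_gt_atTop k, eventually_gt_atTop m] with i hk hm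
    exact (hp i k (Finset.mem_range.2 hk) m (Finset.mem_range.2 hm)).le
  have step : ∀ m f, Tendsto (fun i => inner ℂ (d m) (V (p i) f)) atTop
      (𝓝 (inner ℂ (d m) (M f))) := fun m f =>
    (isClosed_setOf_tendsto_inner_right (V := fun i => V (p i)) (fun i => hV (p i))
      (d m)).closure_subset_iff.2 (by rintro _ ⟨k, rfl⟩; exact key k m) (hd f)
  exact fun f g =>
    (isClosed_setOf_tendsto_inner_left (V := fun i => V (p i)) (fun i => hV (p i))
      f).closure_subset_iff.2 (by rintro _ ⟨m, rfl⟩; exact step m f) (hd g)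

/-- If all measures were `0` or `1`, almost every point would belong to the same separating sets,
and `μ` would be a point mass. -/
lemma exists_measureReal_ne_zero_one [StandardBorelSpace X] [NullSingletonClass μ] :
    ∃ A : Set X, MeasurableSet A ∧ 0 < μ.real A ∧ μ.real A < 1 := by
  obtain ⟨C, hC, hsep⟩ := exists_separating_seq X
  by_contra! hcon
  have h1 : ∀ᵐ x ∂μ, ∀ i, (x ∈ C i ↔ 0 < μ.real (C i)) := by
    rw [ae_all_iff]
    intro i
    by_cases h0 : 0 < μ.real (C i)
    · have h2 : μ (C i)ᶜ = 0 := by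
        rw [← measureReal_eq_zero_iff, measureReal_compl (hC i), probReal_univ]
        linarith [hcon _ (hC i) h0, measureReal_le_one (μ := μ) (s := C i)]
      filter_upwards [compl_mem_ae_iff.2 h2] with x hx
      simpa [h0] using hx
    · have h2 : μ (C i) = 0 := by
        rw [← measureReal_eq_zero_iff]
        exact le_antisymm (not_lt.1 h0) measureReal_nonneg
      filter_upwards [measure_eq_zero_iff_ae_notMem.1 h2] with x hx
      simp [h0, hx]
  obtain ⟨x, hx⟩ := h1.exists
  have h2 : ∀ᵐ y ∂μ, y = x := by
    filter_upwards [h1] with y hy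
    exact hsep y x fun i => (hy i).trans (hx i).symm
  obtain ⟨y, hy, hy'⟩ := (h2.and (measure_eq_zero_iff_ae_notMem.1 (measure_singleton x))).exists
  exact hy' hy

theorem isKappaMixing_half [StandardBorelSpace X] [NullSingletonClass μ] {T : X ≃ᵐ X}
    (hT : MeasurePreserving T μ μ) (hS : Ergodic (T.prodCongr T) (μ.prod μ))
    (hr : localRank (T.prodCongr T) (μ.prod μ) = 1 / 4) : IsKappaMixing T hT (1 / 2) := by
  refine ⟨by norm_num, ?_⟩
  set M : Lp ℂ 2 μ →L[ℂ] Lp ℂ 2 μ := (1 - ((1 / 2 : ℝ) : ℂ)) • ContinuousLinearMap.id ℂ (Lp ℂ 2 μ) +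
    ((1 / 2 : ℝ) : ℂ) • theta μ with hM
  have hMf : ∀ f, M f = (1 / 2 : ℂ) • f + (1 / 2 : ℂ) • theta μ f := by
    intro f
    rw [hM]
    simp only [add_apply, smul_apply,
      ContinuousLinearMap.id_apply]
    push_cast
    norm_num
  have hV : ∀ (n : ℕ) f, ‖(koopman T hT ^ n) f‖ ≤ ‖f‖ := fun n f => (norm_koopman_pow hT n f).le
  -- Times are first indexed by the directed set of finite families of sets with a precision;
  -- separability of `L²` later extracts a sequence.
  have ex : ∀ p : Finset {A : Set X // MeasurableSet A} × ℕ, ∃ n, ∀ A ∈ p.1, ∀ B ∈ p.1,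
      |μ.real (A.1 ∩ T^[n] ⁻¹' B.1) -
        (μ.real (A.1 ∩ B.1) / 2 + μ.real A.1 * μ.real B.1 / 2)| ≤ 1 / ((p.2 : ℝ) + 1) := by
    rintro ⟨s, k⟩
    obtain ⟨n, hn⟩ := exists_half_mixing_time hT hS hr (A := fun i => (s.equivFin.symm i).1.1)
      (fun i => (s.equivFin.symm i).1.2) (show (0 : ℝ) < 1 / ((k : ℝ) + 1) by positivity)
    refine ⟨n, fun A hA B hB => ?_⟩
    simpa using hn (s.equivFin ⟨A, hA⟩) (s.equivFin ⟨B, hB⟩)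
  choose n hn using ex
  have hlim : ∀ f g : Lp ℂ 2 μ,
      Tendsto (fun p => inner ℂ g ((koopman T hT ^ n p) f)) atTop (𝓝 (inner ℂ g (M f))) := by
    refine fun f g => tendsto_inner_of_tendsto_inner_ind (V := fun p => koopman T hT ^ n p)
      (fun p => hV _) (fun A B hA hB => ?_) f g
    have e1 : inner ℂ (ind μ hA) (M (ind μ hB)) =
        ((μ.real (A ∩ B) / 2 + μ.real A * μ.real B / 2 : ℝ) : ℂ) := by
      rw [hMf, theta_ind, inner_add_right, inner_smul_right, inner_smul_right, inner_smul_right,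
        ← ind_univ, inner_ind_ind, inner_ind_ind, Set.inter_univ]
      push_cast
      ring
    simp only [koopman_pow_ind, inner_ind_ind, e1]
    refine (Complex.continuous_ofReal.tendsto _).comp (Metric.tendsto_nhds.2 fun ε hε => ?_)
    obtain ⟨k, hk⟩ := exists_nat_one_div_lt hε
    classical
    filter_upwards [eventually_ge_atTop (({⟨A, hA⟩, ⟨B, hB⟩} : Finset _), k)] with p hp
    refine lt_of_le_of_lt (hn p ⟨A, hA⟩ (hp.1 (by simp)) ⟨B, hB⟩ (hp.1 (by simp))) ?_
    refine lt_of_le_of_lt ?_ hk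
    have : (k : ℝ) ≤ p.2 := by exact_mod_cast hp.2
    gcongr
  have : Fact ((2 : ℝ≥0∞) ≠ ⊤) := ⟨by norm_num⟩
  obtain ⟨q, hq⟩ := exists_seq_tendsto_inner (V := fun p => koopman T hT ^ n p)
    (fun p => hV _) hlim
  refine ⟨fun i => n (q i), ?_, hq⟩
  -- A value `v` taken infinitely often would force `koopman T hT ^ v = M`. But the former is
  -- isometric, while `M` halves functions of mean zero.
  have hne : ∀ v, ∀ᶠ i in atTop, n (q i) ≠ v := by
    intro v
    by_contra hfr
    have hfr' : ∃ᶠ i in atTop, n (q i) = v := fun h => hfr h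
    have heq : ∀ f, (koopman T hT ^ v) f = M f := fun f => by
      refine ext_inner_left ℂ fun g => ?_
      exact (tendsto_nhds_unique_of_frequently_eq (hq f g) tendsto_const_nhds
        (hfr'.mono fun i hi => by rw [hi])).symm
    obtain ⟨A, hA, hA0, hA1⟩ := exists_measureReal_ne_zero_one (μ := μ)
    set f : Lp ℂ 2 μ := ind μ hA - (μ.real A : ℂ) • Lp.const 2 μ (1 : ℂ) with hf
    have hθ : theta μ f = 0 := by
      rw [hf, map_sub, theta_ind, map_smul, ← ind_univ, theta_ind, probReal_univ,
        Complex.ofReal_one, one_smul, ind_univ, sub_self]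
    have h1 : ‖f‖ = 1 / 2 * ‖f‖ := by
      conv_lhs => rw [← norm_koopman_pow hT v f, heq, hMf, hθ, smul_zero, add_zero, norm_smul]
      norm_num
    have h2 : f = 0 := norm_eq_zero.1 (by linarith)
    have h3 : inner ℂ (ind μ hA) f = ((μ.real A * (1 - μ.real A) : ℝ) : ℂ) := by
      rw [hf, inner_sub_right, inner_smul_right, ← ind_univ, inner_ind_ind, inner_ind_ind,
        Set.inter_self, Set.inter_univ]
      push_cast
      ring
    rw [h2, inner_zero_right] at h3
    have h4 : μ.real A * (1 - μ.real A) = 0 := by exact_mod_cast h3.symm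
    nlinarith
  rw [tendsto_atTop]
  intro K
  filter_upwards [(Finset.eventually_all (Finset.range K)).2 fun v _ => hne v] with i hi
  by_contra! hlt
  exact hi _ (Finset.mem_range.2 hlt) rfl

end WeakOperatorLimits

end ErgodicRank

theorem mainTheorem8 {X : Type*} [MeasurableSpace X] [StandardBorelSpace X]
    (μ : Measure X) [IsProbabilityMeasure μ] [NullSingletonClass μ]
    (T : X ≃ᵐ X) (hT : MeasurePreserving T μ μ) :
    ErgodicRank.rank (T.prodCongr T) (μ.prod μ) = ⊤ ∧
    ErgodicRank.localRank (T.prodCongr T) (μ.prod μ) ≤ 1 / 4 ∧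
    (Ergodic (T.prodCongr T) (μ.prod μ) →
      ErgodicRank.localRank (T.prodCongr T) (μ.prod μ) = 1 / 4 →
      ErgodicRank.IsKappaMixing T hT (1 / 2)) :=
  ⟨ErgodicRank.rank_prodCongr_eq_top hT, ErgodicRank.localRank_prodCongr_le hT,
    ErgodicRank.isKappaMixing_half hT⟩
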